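/- Throughout, formulas and elementary extensions are in the language of rings. Let $K$ be a henselian field, i.e. a field that carries a nontrivial henselian valuation. Let $E\subseteq K$ be an existentially generated subfield: there are an existential formula $\phi(x;\mathbf{y})$ and a finite tuple $\mathbf{q}$ of parameters from $K$ such that the set $X=\phi(K;\mathbf{q})\subseteq K$ is infinite and $E=(X)$ is the subfield of $K$ generated by $X$. Then $E=(X)$ is a uniformly big subfield of $K$. That is, for every elementary extension $K\preceq K^{*}$, writing $X^{*}=\phi(K^{*};\mathbf{q})$ and $E^{(*)}=(X^{*})$ for the subfield of $K^{*}$ generated by $X^{*}$, the algebraic exponent $$\mathrm{algex}(K^{*}/E^{(*)})=\sup\{[E^{(*)}(a):E^{(*)}] : a\in K^{*}\}$$ is finite, where a transcendental element $a$ has degree $\infty$. -/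

import Mathlib

open scoped FirstOrder

universe u v w

namespace BigSubfield

open FirstOrder

/-- The set `φ(F; q)` defined in `F` by the formula `φ(x; y₁, …, yₙ)` of the language of rings, with
one free variable `x` (the index `Sum.inr ()`), with the parameter tuple `q` substituted for `y`. -/
def definedSet {F : Type u} [Field F] [Ring.CompatibleRing F] {n : ℕ}
    (φ : Language.ring.Formula (Fin n ⊕ Unit)) (q : Fin n → F) : Set F :=
  {x | φ.Realize (Sum.elim q fun _ => x)}

/-- The subfield `(X)` of `F` generated by `X = φ(F; q)`. -/
def generatedSubfield {F : Type u} [Field F] [Ring.CompatibleRing F] {n : ℕ}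
    (φ : Language.ring.Formula (Fin n ⊕ Unit)) (q : Fin n → F) : Subfield F :=
  Subfield.closure (definedSet φ q)

/-- The subfield `E` of `F` is existentially generated, as witnessed by the formula `φ(x; q)`:
`φ` is existential, `X = φ(F; q)` is infinite, and `E = (X)`. -/
structure ExistentiallyGeneratedBy {F : Type u} [Field F] [Ring.CompatibleRing F] (E : Subfield F)
    {n : ℕ} (φ : Language.ring.Formula (Fin n ⊕ Unit)) (q : Fin n → F) : Prop where
  isExistential : φ.IsExistential
  infinite : (definedSet φ q).Infinite
  eq_generated : E = generatedSubfield φ q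

/-- The algebraic exponent of `F / E`: the supremum in `ℕ∞` of the degrees `[E(a) : E]`, `a ∈ F`
(the degree is `⊤` if `a` is transcendental over `E`). It is the maximum of the degrees if there is
a finite one, and `⊤` otherwise. -/
noncomputable def algex {F : Type u} [Field F] (E : Subfield F) : ℕ∞ :=
  ⨆ a : F, Cardinal.toENat (Module.rank E (IntermediateField.adjoin E {a}))

/-- `E` is a big subfield of `F`. -/
def IsBig {F : Type u} [Field F] (E : Subfield F) : Prop :=
  algex E < ⊤

/-- `E = (X)`, where `X = φ(F; q)`, is a uniformly big subfield of `F`: for every elementary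
extension `F'` of `F` in the language of rings, the subfield generated by the set that `φ(x; q)`
defines in `F'` is big in `F'`. -/
def IsUniformlyBig {F : Type u} [Field F] [Ring.CompatibleRing F] {n : ℕ}
    (φ : Language.ring.Formula (Fin n ⊕ Unit)) (q : Fin n → F) : Prop :=
  ∀ (F' : Type w) [Field F'] [Ring.CompatibleRing F'] (j : F ↪ₑ[Language.ring] F'),
    IsBig (generatedSubfield φ (j ∘ q))

end BigSubfield

/-!
Let `X = φ(K; q)` be infinite, `E = (X)`, and let `p` be the characteristic exponent of `K`. The
point is to find a power `Q = pᵐ` and finitely many `ε₁, …, ε_r ∈ E` such that every `a ∈ K`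
satisfies `a ^ Q * ∑ εᵢ (y'ᵢ - x₀) = ∑ εᵢ (yᵢ - x₀)` for suitable `yᵢ, y'ᵢ, x₀ ∈ X`, with a nonzero
sum on the left. This is a first-order property of the parameters `q` and `ε`
(`BigSubfield.quotientFormula`), so it passes to every elementary extension `K'` of `K`, where it
says that `a ^ Q ∈ E'` for all `a`. Hence every `a` is a root of a polynomial `T ^ Q - c` over `E'`,
and the algebraic exponent is at most `Q`, the same bound for all elementary extensions.

To find `Q` and `ε`, a piece of `X` is seen as the set of values of a regular function. Since `X` is
infinite, there are a finitely generated domain `A` over `K` whose rational points are dense and a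
transcendental `x ∈ A` all of whose values at rational points lie in `X`
(`BigSubfield.exists_transcendental_of_infinite`). If `x` had a nonzero differential, then Hensel's
lemma at a smooth rational point would show that `X` contains a ball, and `Q = 1` would do. In
positive characteristic the differential may vanish, and the proof extracts `p`-th powers:

* Let `F` be the fraction field of `A`. There is a largest `Q = pᵐ` such that `x` is in the `K`-span
  of the `Q`-th powers of `F`. By maximality, whenever `x = ∑ cᵢ gᵢ ^ Q` with `cᵢ ∈ K`, some `gᵢ` has
  a nonzero derivative (`exists_mem_span_pow_and_exists_derivation`): an element on which all
  derivations over `K` vanish is itself in the `K`-span of the `p`-th powers.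
* After localizing, `A` is smooth and the `gᵢ` are in `A`. Because `x` takes values in `E` at a dense
  set of points, the coefficients may be taken in `E`
  (`Algebra.HasDensePoints.mem_span_subfield`), and then to be a basis `ε` of a finite extension of
  `K ^ Q` (`exists_eq_sum_smul_pow_of_mem_span_subfield`). So `x = ∑ εₖ hₖ ^ Q`, where the span of
  `ε` over `K ^ Q` is closed under products.
* For rational points `P₁, …, P_r`, expanding the products `εᵢ εⱼ` gives
  `∑ εᵢ x(Pᵢ) = ∑ εₖ sₖ ^ Q` with `sₖ` linear in the `hⱼ(Pᵢ)`. The map `(Pᵢ) ↦ (sₖ)` is a submersion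
  at some point `(P, …, P)` of the diagonal: on the tangent vectors `tᵢ v`, where `v` is tangent at
  `P` with `γⱼ = dhⱼ(v)` not all zero, its differential is, up to Frobenius, multiplication of
  `∑ εᵢ tᵢ ^ Q` by the nonzero element `∑ εⱼ γⱼ ^ Q`. By Hensel's lemma in several variables
  (`Valuation.exists_eval_eq_add_of_surjective`), every `∑ εₖ αₖ ^ Q` with small `α` is of the form
  `∑ εᵢ (yᵢ - x₀)` (`Valuation.exists_algHom_sum_mul_eq`).
* For `a ∈ K` and small `s ≠ 0`, both `εₖ (a s) ^ Q` and `εₖ s ^ Q` are of this form, and their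
  quotient is `a ^ Q`.
-/

/-! ### Hensel's lemma in several variables -/

section Hensel

open IsLocalRing MvPolynomial

/-- A residue point of an étale algebra over a henselian local ring lifts to a section: locally the
algebra is standard étale, where this is Hensel's lemma for one polynomial. -/
theorem HenselianLocalRing.exists_algHom_of_etale {O S : Type*} [CommRing O] [HenselianLocalRing O]
    [CommRing S] [Algebra O S] [Algebra.Etale O S] (φ : S →ₐ[O] ResidueField O) :
    ∃ ψ : S →ₐ[O] O, ∀ s, residue O (ψ s) = φ s := by
  have hQ : (RingHom.ker φ).IsPrime := RingHom.ker_isPrime _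
  have : Algebra.FormallyEtale S (Localization.AtPrime (RingHom.ker φ)) :=
    Algebra.FormallyEtale.of_isLocalization (RingHom.ker φ).primeCompl
  have : Algebra.IsEtaleAt O (RingHom.ker φ) := Algebra.FormallyEtale.comp O S _
  obtain ⟨f, hf, ⟨⟨P⟩⟩⟩ := Algebra.IsEtaleAt.exists_isStandardEtale (R := O) (RingHom.ker φ)
  let φ' : Localization.Away f →ₐ[O] ResidueField O :=
    IsLocalization.Away.liftAlgHom (S := Localization.Away f) f (f := φ)
      (isUnit_iff_ne_zero.2 hf)
  have hx := P.hasMap.map φ'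
  obtain ⟨a₀, ha₀⟩ := residue_surjective (φ' P.x)
  have key : ∀ p : Polynomial O, Polynomial.aeval (φ' P.x) p = residue O (p.eval a₀) := by
    intro p
    rw [← ha₀, ← ResidueField.algebraMap_eq, Polynomial.aeval_algebraMap_apply]
    simp
  have h1 : P.f.eval a₀ ∈ maximalIdeal O := by
    rw [← residue_eq_zero_iff, ← key]; exact hx.1
  have h2 : IsUnit (P.f.derivative.eval a₀) := by
    have := hx.isUnit_derivative_f
    rw [key] at this
    exact (isUnit_map_iff _ _).1 this
  obtain ⟨a, ha, haa⟩ := HenselianLocalRing.is_henselian P.f P.monic_f a₀ h1 h2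
  have hra : residue O a = residue O a₀ := by
    rw [← sub_eq_zero, ← map_sub]; exact (residue_eq_zero_iff _).2 haa
  have hm : P.P.HasMap a := by
    refine ⟨by simpa using! ha, ?_⟩
    have := hx.2
    rw [← ha₀, ← hra, ← ResidueField.algebraMap_eq, Polynomial.aeval_algebraMap_apply] at this
    exact (isUnit_map_iff (residue O) _).1 this
  let ψ : Localization.Away f →ₐ[O] O := (P.P.lift a hm).comp P.equivRing.toAlgHom
  have hψ : (IsScalarTower.toAlgHom O O (ResidueField O)).comp ψ = φ' := by
    apply P.hom_ext
    simp [ψ, hra, ha₀, ResidueField.algebraMap_eq]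
  refine ⟨ψ.comp (IsScalarTower.toAlgHom O S _), fun s ↦ ?_⟩
  have := congr($hψ (algebraMap S _ s))
  simpa [φ', ResidueField.algebraMap_eq] using this

/-- Hensel's lemma for `n` polynomials in `n` variables: inverting the Jacobian determinant makes the
quotient by the polynomials an étale algebra. -/
theorem HenselianLocalRing.exists_mvPolynomial_root {O ι : Type*} [CommRing O]
    [HenselianLocalRing O] [Fintype ι] [DecidableEq ι] (f : ι → MvPolynomial ι O)
    (a : ι → O) (hf : ∀ i, eval a (f i) ∈ maximalIdeal O)
    (hJ : IsUnit (Matrix.of fun i j ↦ eval a (pderiv i (f j))).det) :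
    ∃ b : ι → O, ∀ i, eval b (f i) = 0 := by
  let P : Algebra.PreSubmersivePresentation O (MvPolynomial ι O ⧸ Ideal.span (Set.range f)) ι ι :=
    .naive id Function.injective_id
  let T := Localization.Away P.jacobian
  let Q := Algebra.PreSubmersivePresentation.localizationAway T P.jacobian
  let PQ : Algebra.SubmersivePresentation O T (Unit ⊕ ι) (Unit ⊕ ι) :=
    { Q.comp P with
      jacobian_isUnit := by
        rw [Algebra.PreSubmersivePresentation.comp_jacobian_eq_jacobian_smul_jacobian,
          Algebra.smul_def, IsUnit.mul_iff,
          Algebra.PreSubmersivePresentation.localizationAway_jacobian, and_self]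
        exact IsLocalization.Away.algebraMap_isUnit _ }
  have : Algebra.IsStandardSmoothOfRelativeDimension 0 O T :=
    PQ.isStandardSmoothOfRelativeDimension (by simp [Algebra.Presentation.dimension])
  have : Algebra.Etale O T := inferInstance
  let φ₀ : (MvPolynomial ι O ⧸ Ideal.span (Set.range f)) →ₐ[O] ResidueField O :=
    Ideal.Quotient.liftₐ _ ((IsScalarTower.toAlgHom O O (ResidueField O)).comp (aeval a)) (by
      intro x hx
      suffices h : Ideal.span (Set.range f) ≤
          RingHom.ker ((IsScalarTower.toAlgHom O O (ResidueField O)).comp (aeval a)) from h hx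
      rw [Ideal.span_le]
      rintro _ ⟨i, rfl⟩
      simpa [ResidueField.algebraMap_eq, aeval_eq_eval] using hf i)
  have hφ₀ : IsUnit (φ₀ P.jacobian) := by
    rw [P.jacobian_eq_jacobiMatrix_det]
    have h : ∀ x : P.Ring, φ₀ (algebraMap P.Ring _ x) = residue O (eval a x) := fun _ ↦ rfl
    rw [h, RingHom.map_det]
    refine RingHom.isUnit_map _ ?_
    convert! hJ
    ext i j
    rw [RingHom.mapMatrix_apply, Matrix.map_apply]
    simp only [P, Algebra.PreSubmersivePresentation.jacobiMatrix_naive, id, Matrix.of_apply]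
  let φ : T →ₐ[O] ResidueField O :=
    IsLocalization.Away.liftAlgHom (S := T) P.jacobian (f := φ₀) hφ₀
  obtain ⟨ψ, -⟩ := HenselianLocalRing.exists_algHom_of_etale φ
  let χ : MvPolynomial ι O →ₐ[O] O :=
    ψ.comp ((IsScalarTower.toAlgHom O (MvPolynomial ι O ⧸ Ideal.span (Set.range f)) T).comp
      (Ideal.Quotient.mkₐ O _))
  refine ⟨χ ∘ X, fun i ↦ ?_⟩
  rw [← aeval_eq_eval, ← aeval_unique χ]
  have : Ideal.Quotient.mkₐ O (Ideal.span (Set.range f)) (f i) = 0 :=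
    Ideal.Quotient.eq_zero_iff_mem.2 (Ideal.subset_span ⟨i, rfl⟩)
  change ψ (algebraMap _ T (Ideal.Quotient.mkₐ O (Ideal.span (Set.range f)) (f i))) = 0
  rw [this, map_zero, map_zero]

end Hensel

/-! ### Openness of polynomial maps over a henselian valued field -/

section Open

open MvPolynomial

theorem MvPolynomial.coeff_bind₁_C_mul_X {R σ : Type*} [CommSemiring R] (c : R)
    (p : MvPolynomial σ R) (m : σ →₀ ℕ) :
    coeff m (bind₁ (fun j ↦ C c * X j) p) = c ^ m.degree * coeff m p := by
  classical
  induction p using MvPolynomial.induction_on' with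
  | monomial s a =>
    have : bind₁ (fun j ↦ C c * X j) (monomial s a) = monomial s (c ^ s.degree * a) := by
      rw [bind₁_monomial, mul_comm, monomial_eq (a := c ^ s.degree * a)]
      simp only [mul_pow, Finsupp.prod, Finset.prod_mul_distrib, Finset.prod_pow_eq_pow_sum,
        Finsupp.degree_apply, C_mul, C_pow]
      ring
    rw [this, coeff_monomial, coeff_monomial]
    split_ifs with h
    · rw [h]
    · simp
  | add p q hp hq => rw [map_add, coeff_add, hp, hq, coeff_add, mul_add]

theorem MvPolynomial.pderiv_bind₁ {R σ τ : Type*} [CommRing R] [Fintype σ]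
    (g : σ → MvPolynomial τ R) (p : MvPolynomial σ R) (k : τ) :
    pderiv k (bind₁ g p) = ∑ i, bind₁ g (pderiv i p) * pderiv k (g i) := by
  classical
  induction p using MvPolynomial.induction_on with
  | C a => simp
  | add p q hp hq => simp only [map_add, hp, hq, add_mul, Finset.sum_add_distrib]
  | mul_X p j hp =>
    simp only [map_mul, bind₁_X_right, pderiv_mul, hp, map_add, add_mul, Finset.sum_add_distrib,
      Finset.sum_mul, pderiv_X, Pi.single_apply]
    congr 1
    · exact Finset.sum_congr rfl fun i _ ↦ by ring
    · simp [apply_ite (bind₁ g), ite_mul]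

/-- Finitely many elements of a valued field have a common denominator in the valuation ring. -/
theorem Valuation.exists_ne_zero_forall_mul_le_one {K : Type*} [Field K] {Γ₀ : Type*}
    [LinearOrderedCommGroupWithZero Γ₀] (val : Valuation K Γ₀) (s : Finset K) :
    ∃ c : K, c ≠ 0 ∧ val c ≤ 1 ∧ ∀ x ∈ s, val (c * x) ≤ 1 := by
  classical
  induction s using Finset.induction_on with
  | empty => exact ⟨1, one_ne_zero, by simp, by simp⟩
  | insert y s _ ih =>
    obtain ⟨c, hc0, hc1, hc⟩ := ih
    rcases le_or_gt (val y) 1 with hy | hy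
    · refine ⟨c, hc0, hc1, fun x hx ↦ ?_⟩
      rcases Finset.mem_insert.1 hx with rfl | hx
      · rw [map_mul]; exact mul_le_one' hc1 hy
      · exact hc x hx
    · have hy0 : y ≠ 0 := by rintro rfl; simp at hy
      have hyi : val y⁻¹ ≤ 1 := by rw [map_inv₀]; exact inv_le_one_of_one_le₀ hy.le
      refine ⟨c * y⁻¹, mul_ne_zero hc0 (inv_ne_zero hy0), ?_, fun x hx ↦ ?_⟩
      · rw [map_mul]; exact mul_le_one' hc1 hyi
      rcases Finset.mem_insert.1 hx with rfl | hx
      · rwa [inv_mul_cancel_right₀ hy0]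
      · rw [mul_right_comm, map_mul]; exact mul_le_one' (hc x hx) hyi

variable {K : Type*} [Field K] {Γ₀ : Type*} [LinearOrderedCommGroupWithZero Γ₀]
  (val : Valuation K Γ₀) [HenselianLocalRing val.valuationSubring]

/-- The inverse function theorem at `0` for a polynomial map `G` with `G 0 = 0` and identity
differential. With `c` a common denominator of the coefficients, the system `c⁻¹ (G (c t) - a) = 0`
in `t` has integral coefficients, and modulo the maximal ideal it has the root `t = 0` with identity
Jacobian there, so Hensel's lemma applies. -/
theorem Valuation.exists_eval_eq_of_linear_part_eq_id {κ : Type*} [Fintype κ] [DecidableEq κ]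
    (G : κ → MvPolynomial κ K) (h0 : ∀ k, coeff 0 (G k) = 0)
    (h1 : ∀ j k, coeff (Finsupp.single j 1) (G k) = if j = k then 1 else 0) :
    ∃ c : K, c ≠ 0 ∧ ∀ a : κ → K, (∀ k, val (a k) < val c) →
      ∃ t : κ → K, ∀ k, eval t (G k) = a k := by
  classical
  obtain ⟨c, hc0, hc1, hc⟩ := val.exists_ne_zero_forall_mul_le_one
    (Finset.univ.biUnion fun k ↦ (G k).support.image fun m ↦ coeff m (G k))
  refine ⟨c, hc0, fun a ha ↦ ?_⟩
  let O := val.valuationSubring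
  let H' : κ → MvPolynomial κ K := fun k ↦ C c⁻¹ * (bind₁ (fun j ↦ C c * X j) (G k) - C (a k))
  have hcoeff : ∀ k m, m ≠ 0 → coeff m (H' k) = c ^ (m.degree - 1) * coeff m (G k) := by
    intro k m hm
    have hd : m.degree ≠ 0 := by rwa [Ne, Finsupp.degree_eq_zero_iff]
    obtain ⟨d, hd⟩ := Nat.exists_eq_succ_of_ne_zero hd
    simp only [H', coeff_C_mul, coeff_sub, coeff_C, if_neg hm.symm, sub_zero, hd,
      coeff_bind₁_C_mul_X, Nat.succ_eq_add_one, Nat.add_sub_cancel, pow_succ]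
    field_simp
  have hcoeff0 : ∀ k, coeff 0 (H' k) = - (c⁻¹ * a k) := by
    intro k
    simp [H', coeff_C_mul, coeff_sub, coeff_bind₁_C_mul_X, h0]
  have hval0 : ∀ k, val (coeff 0 (H' k)) < 1 := by
    intro k
    rw [hcoeff0, Valuation.map_neg, map_mul, map_inv₀,
      inv_mul_lt_one₀ (zero_lt_iff.2 ((Valuation.ne_zero_iff _).2 hc0))]
    exact ha k
  have hO : ∀ k, H' k ∈ Set.range (MvPolynomial.map (algebraMap O K)) := by
    intro k
    rw [mem_range_map_iff_coeffs_subset]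
    intro x hx
    obtain ⟨m, hm, rfl⟩ := mem_coeffs_iff.1 hx
    suffices h : val (coeff m (H' k)) ≤ 1 from ⟨⟨_, h⟩, rfl⟩
    by_cases hm0 : m = 0
    · rw [hm0]; exact (hval0 k).le
    by_cases hGm : coeff m (G k) = 0
    · rw [hcoeff k m hm0, hGm]; simp
    rw [hcoeff k m hm0]
    obtain ⟨d, hd⟩ := Nat.exists_eq_succ_of_ne_zero
      (show m.degree ≠ 0 by rwa [Ne, Finsupp.degree_eq_zero_iff])
    rw [hd, Nat.succ_eq_add_one, Nat.add_sub_cancel]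
    cases d with
    | zero =>
      obtain ⟨j, rfl⟩ : ∃ j, m = Finsupp.single j 1 := (Finsupp.sum_eq_one_iff m).1 hd
      rw [h1]; split_ifs <;> simp
    | succ d =>
      have := hc (coeff m (G k)) (Finset.mem_biUnion.2 ⟨k, Finset.mem_univ _,
        Finset.mem_image.2 ⟨m, mem_support_iff.2 hGm, rfl⟩⟩)
      rw [pow_succ, mul_assoc, map_mul, map_pow]
      exact mul_le_one' (pow_le_one' hc1 d) this
  choose H hH using hO
  have hinj : Function.Injective (algebraMap O K) := IsFractionRing.injective O K
  have hcH : ∀ k m, algebraMap O K (coeff m (H k)) = coeff m (H' k) := by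
    intro k m; rw [← hH, coeff_map]
  obtain ⟨t, ht⟩ := HenselianLocalRing.exists_mvPolynomial_root H 0 (by
    intro k
    rw [eval_zero, constantCoeff_eq, IsLocalRing.mem_maximalIdeal, mem_nonunits_iff,
      (Valuation.valuationSubring.integers val).isUnit_iff_valuation_eq_one, hcH]
    exact (hval0 k).ne) (by
    suffices h : Matrix.of (fun i j ↦ eval (0 : κ → O) (pderiv i (H j))) = 1 by
      rw [h, Matrix.det_one]; exact isUnit_one
    ext i j
    have : coeff 0 (pderiv i (H j)) = if i = j then 1 else 0 := by
      apply hinj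
      rw [coeff_pderiv, zero_add, map_mul, hcH, hcoeff _ _ (by simp), h1]
      simp [apply_ite (algebraMap O K)]
    simp [eval_zero, constantCoeff_eq, this, Matrix.one_apply])
  refine ⟨fun j ↦ c * t j, fun k ↦ ?_⟩
  have h := congr(algebraMap O K $(ht k))
  rw [map_zero, map_eval, hH] at h
  simp only [H', map_mul, eval_C, mul_eq_zero, inv_eq_zero, hc0, false_or] at h
  rw [RingHom.map_sub, eval_C, sub_eq_zero, ← aeval_eq_eval, aeval_bind₁] at h
  rw [← h]
  simp [aeval_eq_eval, Function.comp_def]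

/-- The image of a polynomial map that is submersive at `P` contains a neighbourhood of the image
of `P`. -/
theorem Valuation.exists_eval_eq_add_of_surjective {ι κ : Type*} [Fintype ι] [Finite κ]
    (F : κ → MvPolynomial ι K) (P : ι → K)
    (hF : Function.Surjective fun (v : ι → K) k ↦ ∑ i, eval P (pderiv i (F k)) * v i) :
    ∃ c : K, c ≠ 0 ∧ ∀ a : κ → K, (∀ k, val (a k) < val c) →
      ∃ x : ι → K, ∀ k, eval x (F k) = eval P (F k) + a k := by
  classical
  cases nonempty_fintype κ
  -- Restrict to an affine subspace through `P` on which the differential is the identity.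
  choose r hr using fun k : κ ↦ hF (Pi.single k 1)
  let g : ι → MvPolynomial κ K := fun i ↦ C (P i) + ∑ k, C (r k i) * X k
  have hg : ∀ i, eval 0 (g i) = P i := by simp [g]
  have hgP : ∀ p, eval 0 (bind₁ g p) = eval P p := by
    intro p
    rw [← aeval_eq_eval, aeval_bind₁, aeval_eq_eval, aeval_eq_eval, funext hg]
  obtain ⟨c, hc, H⟩ := val.exists_eval_eq_of_linear_part_eq_id
    (fun k ↦ bind₁ g (F k) - C (eval P (F k)))
    (by
      intro k
      rw [← constantCoeff_eq, ← eval_zero, RingHom.map_sub, hgP, eval_C, sub_self])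
    (by
      intro j k
      have h := coeff_pderiv (i := j) (bind₁ g (F k) - C (eval P (F k))) 0
      rw [zero_add, Finsupp.coe_zero, Pi.zero_apply, Nat.cast_zero, zero_add, mul_one] at h
      rw [← h, ← constantCoeff_eq, ← eval_zero, Derivation.map_sub, pderiv_C, sub_zero,
        pderiv_bind₁, map_sum]
      have h2 := congr_fun (hr j) k
      rw [Pi.single_apply] at h2
      simp only [eq_comm (a := j), ← h2]
      refine Finset.sum_congr rfl fun i _ ↦ ?_
      rw [map_mul, hgP]
      congr 1
      simp [g, pderiv_X, Pi.single_apply])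
  refine ⟨c, hc, fun a ha ↦ ?_⟩
  obtain ⟨t, ht⟩ := H a ha
  refine ⟨fun i ↦ eval t (g i), fun k ↦ ?_⟩
  have h := ht k
  rw [RingHom.map_sub, eval_C, sub_eq_iff_eq_add', ← aeval_eq_eval, aeval_bind₁] at h
  simpa [aeval_eq_eval] using h

end Open

/-! ### Derivations of finitely generated field extensions -/

section Derivations

open IntermediateField

theorem Derivation.eq_zero_of_isSeparable {L F : Type*} [Field L] [Field F] [Algebra L F]
    [Algebra.IsSeparable L F] (D : Derivation L F F) : D = 0 := by
  have := Algebra.FormallyUnramified.of_isSeparable L F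
  rw [← D.liftKaehlerDifferential_comp, Subsingleton.elim D.liftKaehlerDifferential 0]
  ext; simp

/-- If `F` is inseparable over `L` but separable over `L(g)`, then `g` is not killed by all
derivations: otherwise every derivation would be `L(g)`-linear, hence zero, and `F` would be
unramified over `L`. -/
theorem Derivation.exists_apply_ne_zero_of_not_isSeparable {L F : Type*} [Field L] [Field F]
    [Algebra L F] [Algebra.EssFiniteType L F] (hL : ¬ Algebra.IsSeparable L F) (g : F)
    [Algebra.IsSeparable L⟮g⟯ F] : ∃ D : Derivation L F F, D g ≠ 0 := by
  by_contra! H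
  refine hL ((Algebra.FormallyUnramified.iff_isSeparable L F).1 ⟨⟨fun ω₁ ω₂ ↦ ?_⟩⟩)
  suffices h : ∀ ω : Ω[F⁄L], ω = 0 by rw [h ω₁, h ω₂]
  intro ω
  rw [← Module.forall_dual_apply_eq_zero_iff F]
  intro f
  suffices h : f = 0 by simp [h]
  have hD : ∀ (D : Derivation L F F), ∀ x ∈ L⟮g⟯, D x = 0 := by
    intro D x hx
    induction hx using IntermediateField.adjoin_induction with
    | mem x hx => rw [Set.mem_singleton_iff.1 hx]; exact H D
    | algebraMap x => exact D.map_algebraMap x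
    | add x y _ _ hx hy => rw [map_add, hx, hy, add_zero]
    | inv x _ hx => rw [Derivation.leibniz_inv, hx, smul_zero]
    | mul x y _ _ hx hy => rw [Derivation.leibniz, hx, hy, smul_zero, smul_zero, add_zero]
  set D := f.compDer (KaehlerDifferential.D L F) with hDdef
  let D' : Derivation L⟮g⟯ F F := Derivation.mk'
    { toFun := D
      map_add' := map_add D
      map_smul' := fun r x ↦ by
        rw [Algebra.smul_def, Derivation.leibniz, show D (algebraMap L⟮g⟯ F r) = 0 from hD D _ r.2,
          smul_zero, add_zero, smul_eq_mul, ← Algebra.smul_def, RingHom.id_apply] }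
    (fun a b ↦ D.leibniz a b)
  have hD0 : ∀ x, D x = 0 := fun x ↦ congr($(D'.eq_zero_of_isSeparable) x)
  apply LinearMap.ext_on (KaehlerDifferential.span_range_derivation L F)
  rintro _ ⟨x, rfl⟩
  exact hD0 x

/-- A transcendental element is part of a transcendence basis; `L` is generated by the others. -/
theorem IntermediateField.exists_isAlgebraic_adjoin_simple_of_transcendental {K F : Type*} [Field K]
    [Field F] [Algebra K F] {x : F} (hx : Transcendental K x) :
    ∃ L : IntermediateField K F, Transcendental L x ∧ Algebra.IsAlgebraic L⟮x⟯ F := by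
  obtain ⟨t, hxt, ht⟩ := exists_isTranscendenceBasis_superset (R := K) (s := {x})
    ((algebraicIndependent_singleton_iff (⟨x, rfl⟩ : ({x} : Set F))).2 hx)
  have hxt : x ∈ t := by simpa using hxt
  refine ⟨adjoin K (t \ {x}), ?_, ?_⟩
  · rw [IntermediateField.transcendental_adjoin_iff]
    have := ht.1.transcendental_adjoin (s := {⟨x, hxt⟩}ᶜ) (i := ⟨x, hxt⟩) (by simp)
    have himg : (Subtype.val '' ({⟨x, hxt⟩}ᶜ : Set t)) = t \ {x} := by
      ext y; simp [and_comm]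
    rwa [himg] at this
  · have := ht.isAlgebraic_field
    rw [Subtype.range_coe] at this
    have heq : adjoin K t = (adjoin K (t \ {x}))⟮x⟯.restrictScalars K := by
      rw [adjoin_adjoin_left, Set.sdiff_union_of_subset (by simpa using hxt)]
    rw [heq] at this
    exact this

theorem Derivation.exists_apply_ne_zero_of_transcendental {K F : Type*} [Field K] [CharZero K]
    [Field F] [Algebra K F] [Algebra.EssFiniteType K F] {x : F} (hx : Transcendental K x) :
    ∃ D : Derivation K F F, D x ≠ 0 := by
  obtain ⟨L, hL, hLx⟩ := exists_isAlgebraic_adjoin_simple_of_transcendental hx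
  have : Algebra.EssFiniteType L F := .of_comp K L F
  have : CharZero L := charZero_of_injective_algebraMap (algebraMap K L).injective
  obtain ⟨D, hD⟩ := Derivation.exists_apply_ne_zero_of_not_isSeparable (L := L) (F := F)
    (fun h ↦ hL (Algebra.IsSeparable.isIntegral L x).isAlgebraic) x
  exact ⟨D.restrictScalars K, hD⟩

/-- A `pⁿ`-th root of an element of `L` whose lower `pᵏ`-th powers are not in `L` has degree at least
`pⁿ` over `L`, since minimal polynomials of purely inseparable elements are of the form
`X ^ pᵏ - y`. -/
theorem minpoly.pow_le_natDegree_of_forall_pow_notMem {L F : Type*} [Field L] [Field F]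
    [Algebra L F] (p : ℕ) [ExpChar L p] {n : ℕ} {x : F} (hx : x ^ p ^ n ∈ (algebraMap L F).range)
    (h : ∀ k < n, x ^ p ^ k ∉ (algebraMap L F).range) : p ^ n ≤ (minpoly L x).natDegree := by
  obtain ⟨k, y, hk⟩ := (minpoly.natSepDegree_eq_one_iff_eq_X_pow_sub_C p).1
    ((minpoly.natSepDegree_eq_one_iff_pow_mem p).2 ⟨n, hx⟩)
  have hp : 0 < p := expChar_pos L p
  rw [hk, Polynomial.natDegree_X_pow_sub_C]
  refine Nat.pow_le_pow_right hp (not_lt.1 fun hkn ↦ h k hkn ⟨y, ?_⟩)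
  have := minpoly.aeval L x
  rw [hk] at this
  rw [map_sub, map_pow, Polynomial.aeval_X, Polynomial.aeval_C, sub_eq_zero] at this
  exact this.symm

/-- If `g ∉ K(Fᵖ)`, then among the intermediate fields containing `Fᵖ` there is a maximal one `L`
that does not contain `g`; it satisfies `F = L(g)` and `[F : L] = p`, so that `d/dg` exists. -/
theorem Derivation.exists_apply_ne_zero_of_notMem_span {K F : Type*} [Field K] [Field F]
    [Algebra K F] [Algebra.EssFiniteType K F] (p : ℕ) [hp : Fact p.Prime] [CharP K p] {g : F}
    (hg : g ∉ Submodule.span K (Set.range fun f : F ↦ f ^ p)) :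
    ∃ D : Derivation K F F, D g ≠ 0 := by
  have : CharP F p := charP_of_injective_algebraMap (algebraMap K F).injective p
  have : ExpChar F p := .prime hp.out
  let S : Submodule K F := Submodule.span K (Set.range fun f : F ↦ f ^ p)
  have hpS : ∀ f : F, f ^ p ∈ S := fun f ↦ Submodule.subset_span ⟨f, rfl⟩
  have hmul : ∀ a ∈ S, ∀ b ∈ S, a * b ∈ S := by
    intro a ha b hb
    have : a * b ∈ S * S := Submodule.mul_mem_mul ha hb
    rw [Submodule.span_mul_span] at this
    refine Submodule.span_mono ?_ this
    rintro _ ⟨_, ⟨x, rfl⟩, _, ⟨y, rfl⟩, rfl⟩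
    exact ⟨x * y, mul_pow x y p⟩
  let M : IntermediateField K F :=
    { carrier := S
      mul_mem' := fun ha hb ↦ hmul _ ha _ hb
      add_mem' := fun ha hb ↦ S.add_mem ha hb
      algebraMap_mem' := fun r ↦ by
        rw [Algebra.algebraMap_eq_smul_one]
        exact S.smul_mem r (by simpa using hpS 1)
      inv_mem' := fun x hx ↦ by
        obtain ⟨m, hm⟩ := Nat.exists_eq_add_of_le hp.out.two_le
        by_cases hx0 : x = 0
        · rw [hx0, inv_zero]; exact S.zero_mem
        have : x⁻¹ = (x⁻¹) ^ p * x ^ (p - 1) := by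
          rw [hm, show 2 + m - 1 = m + 1 by omega, add_comm 2 m, inv_pow, pow_succ x (m + 1),
            mul_inv, mul_comm (x ^ (m + 1))⁻¹, inv_mul_cancel_right₀ (pow_ne_zero _ hx0)]
        rw [this]
        refine hmul _ (hpS _) _ ?_
        induction p - 1 with
        | zero => simpa using hpS 1
        | succ k ih => rw [pow_succ]; exact hmul _ ih _ hx }
  obtain ⟨L, hML, hL⟩ := zorn_le_nonempty₀ {L : IntermediateField K F | g ∉ L} (by
    intro c hc hchain y hy
    have : Nonempty c := ⟨⟨y, hy⟩⟩
    have hdir : Directed (· ≤ ·) (fun L : c ↦ (L : IntermediateField K F)) :=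
      hchain.directedOn.directed_val
    refine ⟨⨆ L : c, (L : IntermediateField K F), ?_, fun z hz ↦
      le_iSup (fun L : c ↦ (L : IntermediateField K F)) ⟨z, hz⟩⟩
    intro hgs
    rw [← SetLike.mem_coe, coe_iSup_of_directed hdir, Set.mem_iUnion] at hgs
    obtain ⟨L, hL⟩ := hgs
    exact hc L.2 hL) M hg
  have hgL : g ∉ L := hL.1
  have hpL : ∀ f : F, f ^ p ∈ L := fun f ↦ hML (hpS f)
  have : CharP L p := charP_of_injective_algebraMap (algebraMap K L).injective p
  have : ExpChar L p := .prime hp.out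
  have : Algebra.EssFiniteType L F := .of_comp K L F
  have hdeg : ∀ h : F, h ∉ L → Module.finrank L L⟮h⟯ = p := by
    intro h hh
    have hint : IsIntegral L h := IsIntegral.of_pow hp.out.pos
      (isIntegral_algebraMap (A := F) (x := (⟨h ^ p, hpL h⟩ : L)))
    rw [adjoin.finrank hint]
    refine le_antisymm ?_ ?_
    · have := Polynomial.natDegree_le_natDegree (minpoly.min L h
        (Polynomial.monic_X_pow_sub_C (⟨h ^ p, hpL h⟩ : L) hp.out.ne_zero) (by
          simp [IntermediateField.algebraMap_apply]))
      rwa [Polynomial.natDegree_X_pow_sub_C] at this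
    · have := minpoly.pow_le_natDegree_of_forall_pow_notMem (L := L) p (n := 1) (x := h)
        ⟨⟨h ^ p, hpL h⟩, by simp [IntermediateField.algebraMap_apply]⟩ (by
          intro k hk
          obtain rfl : k = 0 := by omega
          rintro ⟨y, hy⟩
          apply hh
          rw [pow_zero, pow_one] at hy
          rw [← hy]; exact y.2)
      rwa [pow_one] at this
  have htop : L⟮g⟯ = ⊤ := by
    rw [eq_top_iff]
    intro h _
    by_cases hh : h ∈ L
    · exact L⟮g⟯.algebraMap_mem ⟨h, hh⟩
    have hgh : g ∈ L⟮h⟯ := by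
      by_contra hgh
      have := hL.2 (y := L⟮h⟯.restrictScalars K) hgh (fun z hz ↦ L⟮h⟯.algebraMap_mem ⟨z, hz⟩)
      exact hh (this (mem_adjoin_simple_self L h))
    have : FiniteDimensional L L⟮h⟯ :=
      Module.finite_of_finrank_pos (by rw [hdeg h hh]; exact hp.out.pos)
    have := eq_of_le_of_finrank_eq (adjoin_simple_le_iff.2 hgh) (by rw [hdeg g hgL, hdeg h hh])
    rw [this]; exact mem_adjoin_simple_self L h
  have : Algebra.IsSeparable L⟮g⟯ F := by
    rw [htop]
    exact ⟨fun y ↦ isSeparable_algebraMap (F := (⊤ : IntermediateField L F)) ⟨y, mem_top⟩⟩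
  obtain ⟨D, hD⟩ := Derivation.exists_apply_ne_zero_of_not_isSeparable (L := L) (F := F)
    (fun hsep ↦ by
      have : Algebra.IsSeparable L F := hsep
      have : IsPurelyInseparable L F := (isPurelyInseparable_iff_pow_mem L p).2
        fun x ↦ ⟨1, ⟨⟨x ^ p, hpL x⟩, by simp [IntermediateField.algebraMap_apply]⟩⟩
      obtain ⟨y, hy⟩ := IsPurelyInseparable.surjective_algebraMap_of_isSeparable L F g
      apply hgL
      rw [← hy]; exact y.2) g
  exact ⟨D.restrictScalars K, hD⟩

end Derivations

/-! ### Expressing an element through `q`-th powers -/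

section FrobeniusHeight

open IntermediateField

theorem IntermediateField.pow_notMem_adjoin_pow {L F : Type*} [Field L] [Field F] [Algebra L F]
    {x : F} (hx : Transcendental L x) {m q : ℕ} (hmq : m < q) (hm : m ≠ 0) :
    x ^ m ∉ L⟮x ^ q⟯ := by
  rw [IntermediateField.mem_adjoin_simple_iff]
  rintro ⟨r, s, h⟩
  have hexp : ∀ f : Polynomial L, Polynomial.aeval (x ^ q) f =
      Polynomial.aeval x (Polynomial.expand L q f) := fun f ↦ (Polynomial.expand_aeval q f x).symm
  have hxm : x ^ m ≠ 0 := by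
    intro h0
    have : x = 0 := by simpa [hm] using h0
    exact hx (this ▸ isAlgebraic_zero)
  have hs : Polynomial.aeval (x ^ q) s ≠ 0 := by
    intro hs; rw [hs, div_zero] at h; exact hxm h
  rw [eq_div_iff hs, hexp, hexp] at h
  have h' : Polynomial.X ^ m * Polynomial.expand L q s = Polynomial.expand L q r := by
    refine (transcendental_iff_injective.1 hx) ?_
    simpa using h
  have hs0 : Polynomial.expand L q s ≠ 0 := by
    intro h0; apply hs; rw [hexp, h0, map_zero]
  have hdeg := congr($(h').natDegree)
  rw [Polynomial.natDegree_mul (pow_ne_zero _ Polynomial.X_ne_zero) hs0, Polynomial.natDegree_X_pow,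
    Polynomial.natDegree_expand, Polynomial.natDegree_expand] at hdeg
  have := (Nat.dvd_add_left (Dvd.intro_left (s.natDegree) rfl)).1 (hdeg ▸ Dvd.intro_left _ rfl)
  exact absurd (Nat.le_of_dvd (Nat.pos_of_ne_zero hm) this) (by omega)

/-- A transcendental element `x` of a finitely generated extension `F` of `K` is not in `K(F^q)` for
large `q = pⁿ`. For a suitable intermediate field `L`, the extension `F` of `L(x)` is finite, and
`x ∈ K(F^q)` implies that `q` is at most its degree: `L(F^q)` is spanned over `L(x^q)` by the `q`-th powers of a basis, and
`1, x, …, x^(q-1)` are independent over `L(x^q)`. -/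
theorem exists_notMem_span_pow_expChar_pow {K F : Type*} [Field K] [Field F]
    [Algebra K F] [Algebra.EssFiniteType K F] (p : ℕ) [hp : Fact p.Prime] [CharP K p] {x : F}
    (hx : Transcendental K x) :
    ∃ n, x ∉ Submodule.span K (Set.range fun f : F ↦ f ^ p ^ n) := by
  have : CharP F p := charP_of_injective_algebraMap (algebraMap K F).injective p
  have : ExpChar F p := .prime hp.out
  obtain ⟨L, hL, hLx⟩ := exists_isAlgebraic_adjoin_simple_of_transcendental hx
  have : CharP L p := charP_of_injective_algebraMap (algebraMap K L).injective p
  have : Algebra.EssFiniteType L F := .of_comp K L F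
  have : Algebra.EssFiniteType L⟮x⟯ F := .of_comp L L⟮x⟯ F
  have : Module.Finite L⟮x⟯ F := Algebra.finite_of_essFiniteType_of_isAlgebraic
  let w := Module.finBasis L⟮x⟯ F
  by_contra! H
  obtain ⟨n, hn⟩ : ∃ n, Module.finrank L⟮x⟯ F < p ^ n := ⟨_, Nat.lt_pow_self hp.out.one_lt⟩
  let N := L⟮x ^ p ^ n⟯
  have : CharP N p := charP_of_injective_algebraMap (algebraMap L N).injective p
  have : ExpChar N p := .prime hp.out
  have hN : ∀ r ∈ L⟮x⟯, r ^ p ^ n ∈ N := by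
    intro r hr
    induction hr using IntermediateField.adjoin_induction with
    | mem y hy => rw [Set.mem_singleton_iff.1 hy]; exact mem_adjoin_simple_self L _
    | algebraMap y => rw [← map_pow]; exact N.algebraMap_mem _
    | add a b _ _ ha hb => rw [add_pow_expChar_pow]; exact N.add_mem ha hb
    | inv a _ ha => rw [inv_pow]; exact N.inv_mem ha
    | mul a b _ _ ha hb => rw [mul_pow]; exact N.mul_mem ha hb
  let S : Submodule N F := Submodule.span N (Set.range fun i ↦ w i ^ p ^ n)
  have hS : ∀ f : F, f ^ p ^ n ∈ S := by
    intro f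
    rw [← w.sum_repr f, sum_pow_char_pow p]
    refine S.sum_mem fun i _ ↦ ?_
    rw [Algebra.smul_def, mul_pow]
    exact S.smul_mem ⟨_, hN _ (w.repr f i).2⟩ (Submodule.subset_span ⟨i, rfl⟩)
  have hKS : ∀ y ∈ Submodule.span K (Set.range fun f : F ↦ f ^ p ^ n), y ∈ S := by
    intro y hy
    induction hy using Submodule.span_induction with
    | mem y hy => obtain ⟨f, rfl⟩ := hy; exact hS f
    | zero => exact S.zero_mem
    | add a b _ _ ha hb => exact S.add_mem ha hb
    | smul a b _ hb =>
      rw [Algebra.smul_def]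
      exact S.smul_mem (⟨_, N.algebraMap_mem (algebraMap K L a)⟩ : N) hb
  have hxS : ∀ j : ℕ, x ^ j ∈ S := by
    intro j
    apply hKS
    induction j with
    | zero => exact Submodule.subset_span ⟨1, by simp⟩
    | succ j ih =>
      rw [pow_succ]
      have := Submodule.mul_mem_mul ih (H n)
      rw [Submodule.span_mul_span] at this
      refine Submodule.span_mono ?_ this
      rintro _ ⟨_, ⟨x, rfl⟩, _, ⟨y, rfl⟩, rfl⟩
      exact ⟨x * y, mul_pow x y _⟩
  have hdeg : p ^ n ≤ (minpoly N x).natDegree := by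
    refine minpoly.pow_le_natDegree_of_forall_pow_notMem p
      ⟨⟨_, mem_adjoin_simple_self L _⟩, rfl⟩ ?_
    rintro k hk ⟨y, hy⟩
    refine pow_notMem_adjoin_pow hL (Nat.pow_lt_pow_right hp.out.one_lt hk)
      (pow_ne_zero k hp.out.ne_zero) ?_
    rw [← hy]
    exact y.2
  have hli : LinearIndependent N fun i : Fin (p ^ n) ↦ x ^ (i : ℕ) :=
    (linearIndependent_pow (K := N) x).comp (Fin.castLE hdeg) (Fin.castLE_injective hdeg)
  classical
  have := linearIndependent_le_span' _ hli (Set.range fun i ↦ w i ^ p ^ n) (by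
    rintro _ ⟨j, rfl⟩; exact hxS j)
  rw [Cardinal.mk_fin, Nat.cast_le] at this
  have h2 := Fintype.card_range_le (fun i ↦ w i ^ p ^ n)
  rw [Fintype.card_fin] at h2
  omega

/-- A transcendental element `x` of a finitely generated extension `F` of `K` lies in `K(F^q)` for a
largest power `q` of the characteristic exponent. In a presentation `x = ∑ cᵢ gᵢ^q`, the `gᵢ` are
then not all killed by the derivations of `F / K`. In characteristic zero, `q = 1`. -/
theorem exists_mem_span_pow_and_exists_derivation {K F : Type*} [Field K] [Field F]
    [Algebra K F] [Algebra.EssFiniteType K F] (p : ℕ) [ExpChar K p] {x : F}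
    (hx : Transcendental K x) :
    ∃ n, x ∈ Submodule.span K (Set.range fun f : F ↦ f ^ p ^ n) ∧
      ∀ {ι : Type w} (s : Finset ι) (c : ι → K) (g : ι → F), x = ∑ i ∈ s, c i • g i ^ p ^ n →
        ∃ i ∈ s, ∃ D : Derivation K F F, D (g i) ≠ 0 := by
  classical
  rcases ‹ExpChar K p› with _ | hp
  · refine ⟨0, Submodule.subset_span ⟨x, by simp⟩, fun {ι} s c g h ↦ ?_⟩
    obtain ⟨D, hD⟩ := Derivation.exists_apply_ne_zero_of_transcendental hx
    by_contra! H
    apply hD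
    rw [h, map_sum]
    refine Finset.sum_eq_zero fun i hi ↦ ?_
    rw [D.map_smul, pow_zero, pow_one, H i hi D, smul_zero]
  · have : Fact p.Prime := ⟨hp⟩
    have : CharP F p := charP_of_injective_algebraMap (algebraMap K F).injective p
    have : ExpChar F p := .prime hp
    have hex := exists_notMem_span_pow_expChar_pow p hx
    obtain ⟨n, hn⟩ := Nat.exists_eq_succ_of_ne_zero (n := Nat.find hex) (by
      intro h0
      refine Nat.find_spec hex ?_
      rw [h0]
      exact Submodule.subset_span ⟨x, by simp⟩)
    refine ⟨n, not_not.1 (Nat.find_min hex (m := n) (by omega)), fun {ι} s c g h ↦ ?_⟩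
    by_contra! H
    refine Nat.find_spec hex ?_
    rw [hn, h]
    refine Submodule.sum_mem _ fun i hi ↦ Submodule.smul_mem _ _ ?_
    have hge : g i ∈ Submodule.span K (Set.range fun f : F ↦ f ^ p) := by
      by_contra hge
      obtain ⟨D, hD⟩ := Derivation.exists_apply_ne_zero_of_notMem_span p hge
      exact hD (H i hi D)
    generalize g i = y at hge
    induction hge using Submodule.span_induction with
    | mem y hy =>
      obtain ⟨f, rfl⟩ := hy
      exact Submodule.subset_span ⟨f, by simp only [Nat.succ_eq_add_one, pow_succ', pow_mul]⟩
    | zero => rw [zero_pow (pow_ne_zero _ hp.ne_zero)]; exact Submodule.zero_mem _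
    | add a b _ _ ha hb => rw [add_pow_expChar_pow]; exact Submodule.add_mem _ ha hb
    | smul a b _ hb => rw [smul_pow]; exact Submodule.smul_mem _ _ hb

end FrobeniusHeight

/-! ### Algebras with a dense set of rational points -/

section DensePoints

/-- The `K`-algebra `A` has a dense set of `K`-rational points: no nonzero element of `A` vanishes
at all of them. For `A` a domain this says that the rational points of `Spec A` are dense. -/
def Algebra.HasDensePoints (K A : Type*) [CommRing K] [CommRing A] [Algebra K A] : Prop :=
  ∀ a : A, a ≠ 0 → ∃ φ : A →ₐ[K] K, φ a ≠ 0

theorem Algebra.HasDensePoints.eq_zero {K A : Type*} [CommRing K] [CommRing A] [Algebra K A]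
    (h : Algebra.HasDensePoints K A) {a : A} (ha : ∀ φ : A →ₐ[K] K, φ a = 0) : a = 0 := by
  by_contra h0
  obtain ⟨φ, hφ⟩ := h a h0
  exact hφ (ha φ)

variable {K A : Type*} [Field K] [CommRing A] [Algebra K A]

/-- If `∑ cᵢ aᵢ^q = 0` in `A`, where `A` has dense rational points, then for every linear form `l`
on `K` over `K^q` the sum `∑ (l cᵢ) aᵢ^q`, which is a `q`-th power, vanishes. -/
theorem Algebra.HasDensePoints.sum_smul_eq_zero (h : Algebra.HasDensePoints K A) (p n : ℕ)
    [ExpChar K p] {ι : Type*} (s : Finset ι) (c : ι → K) (a : ι → A)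
    (hs : ∑ i ∈ s, c i • a i ^ p ^ n = 0)
    (l : K →ₗ[(iterateFrobenius K p n).fieldRange] (iterateFrobenius K p n).fieldRange)
    (d : ι → K) (hd : ∀ i ∈ s, d i ^ p ^ n = l (c i)) :
    ∑ i ∈ s, d i • a i = 0 := by
  refine h.eq_zero fun φ ↦ ?_
  have h1 := congr(l (φ $hs))
  simp only [map_sum, map_smul, map_zero, map_pow, smul_eq_mul] at h1 ⊢
  have h2 : ∀ i ∈ s, ((l (c i * φ (a i) ^ p ^ n) : (iterateFrobenius K p n).fieldRange) : K) =
      (d i * φ (a i)) ^ p ^ n := by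
    intro i hi
    let r : (iterateFrobenius K p n).fieldRange :=
      ⟨φ (a i) ^ p ^ n, ⟨φ (a i), by simp [iterateFrobenius_def]⟩⟩
    have : c i * φ (a i) ^ p ^ n = r • c i := by
      rw [Subfield.smul_def, smul_eq_mul, mul_comm]
    rw [this, map_smul, mul_pow, hd i hi, smul_eq_mul, mul_comm]
    rfl
  have h3 := congr(Subtype.val $h1)
  rw [AddSubmonoidClass.coe_finsetSum, Finset.sum_congr rfl h2, ← sum_pow_char_pow p] at h3
  exact pow_eq_zero_iff (pow_ne_zero _ (expChar_ne_zero K p)) |>.1 h3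

variable [IsDomain A]

theorem Algebra.HasDensePoints.localizationAway (h : Algebra.HasDensePoints K A) {f : A}
    (hf : f ≠ 0) : Algebra.HasDensePoints K (Localization.Away f) := by
  intro a ha
  obtain ⟨⟨b, s⟩, hb⟩ := IsLocalization.surj (Submonoid.powers f) a
  have hb0 : b ≠ 0 := by
    rintro rfl
    rw [map_zero] at hb
    exact ha ((IsLocalization.map_units _ s).mul_left_eq_zero.1 hb)
  obtain ⟨φ, hφ⟩ := h (b * f) (mul_ne_zero hb0 hf)
  rw [map_mul, mul_ne_zero_iff] at hφ
  let ψ : Localization.Away f →ₐ[K] K :=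
    IsLocalization.Away.liftAlgHom (S := Localization.Away f) f (f := φ)
      (isUnit_iff_ne_zero.2 hφ.2)
  refine ⟨ψ, fun h0 ↦ hφ.1 ?_⟩
  have h1 : ψ (algebraMap A _ b) = φ b := by simp [ψ]
  rw [← h1, ← hb, map_mul, h0, zero_mul]

/-- If the rational points are dense, then `p`-th powers of linearly independent elements of the
function field are linearly independent. This is MacLane's criterion for the function field to be
separable over `K`. -/
theorem Algebra.HasDensePoints.linearIndepOn_pow (h : Algebra.HasDensePoints K A) (F : Type*)
    [Field F] [Algebra A F] [IsFractionRing A F] [Algebra K F] [IsScalarTower K A F]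
    (p : ℕ) [ExpChar K p] (s : Finset F)
    (hs : LinearIndepOn K _root_.id (s : Set F)) : LinearIndepOn K (· ^ p) (s : Set F) := by
  rw [linearIndepOn_finset_iff] at hs ⊢
  intro c hc i hi
  obtain ⟨b, hb⟩ := IsLocalization.exist_integer_multiples_of_finset (nonZeroDivisors A) s
  choose! a ha using hb
  rw [← Module.forall_dual_apply_eq_zero_iff (iterateFrobenius K p 1).fieldRange]
  intro l
  choose d hd using fun i ↦ (l (c i)).2
  have hinj := IsFractionRing.injective A F
  have hb0 : algebraMap A F b ≠ 0 := by
    simp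
  have h1 : ∑ i ∈ s, d i • a i = 0 := by
    refine h.sum_smul_eq_zero p 1 s c a ?_ l d fun i _ ↦ by
      rw [← hd, iterateFrobenius_def]
    apply hinj
    rw [map_zero, map_sum]
    have h2 : ∀ i ∈ s, algebraMap A F (c i • a i ^ p ^ 1) =
        algebraMap A F b ^ p * (c i • i ^ p) := by
      intro i hi
      rw [Algebra.smul_def, map_mul, map_pow, ha i hi, ← IsScalarTower.algebraMap_apply, pow_one,
        Algebra.smul_def, mul_pow, Algebra.smul_def]
      ring
    rw [Finset.sum_congr rfl h2, ← Finset.mul_sum, hc, mul_zero]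
  have h3 := hs d (by
    have h4 := congr(algebraMap A F $h1)
    rw [map_sum, map_zero] at h4
    have h5 : ∀ i ∈ s, algebraMap A F (d i • a i) = algebraMap A F b * (d i • i) := by
      intro i hi
      rw [Algebra.smul_def, map_mul, ha i hi, ← IsScalarTower.algebraMap_apply,
        Algebra.smul_def, Algebra.smul_def]
      ring
    rw [Finset.sum_congr rfl h5, ← Finset.mul_sum] at h4
    exact (mul_eq_zero.1 h4).resolve_left hb0) i hi
  apply Subtype.ext
  rw [← hd, h3, map_zero]
  rfl

theorem Algebra.HasDensePoints.formallySmooth_fractionRing (h : Algebra.HasDensePoints K A)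
    (F : Type*) [Field F] [Algebra A F] [IsFractionRing A F] [Algebra K F] [IsScalarTower K A F]
    [Algebra.EssFiniteType K F] : Algebra.FormallySmooth K F := by
  obtain ⟨p, hp⟩ := ExpChar.exists K
  obtain _ | hp' := hp
  · infer_instance
  have : ExpChar K p := .prime hp'
  obtain ⟨s, hs, hsep⟩ :=
    exists_isTranscendenceBasis_and_isSeparable_of_linearIndepOn_pow_of_essFiniteType p hp'
      (h.linearIndepOn_pow F p)
  have : Algebra.IsSeparable (IntermediateField.adjoin K (Set.range ((↑) : s → F))) F := by
    rw [show Set.range ((↑) : s → F) = (s : Set F) from Subtype.range_coe]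
    exact hsep
  exact .of_algebraicIndependent_of_isSeparable hs.1

/-- A variety with dense rational points is generically smooth. -/
theorem Algebra.HasDensePoints.exists_isStandardSmooth [Algebra.FiniteType K A]
    (h : Algebra.HasDensePoints K A) :
    ∃ f : A, f ≠ 0 ∧ Algebra.IsStandardSmooth K (Localization.Away f) := by
  have : Algebra.FinitePresentation K A := Algebra.FinitePresentation.of_finiteType.1 inferInstance
  have : IsFractionRing A (Localization.AtPrime (⊥ : Ideal A)) := by
    change IsLocalization (nonZeroDivisors A) (Localization (⊥ : Ideal A).primeCompl)
    have : nonZeroDivisors A = (⊥ : Ideal A).primeCompl := by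
      ext; simp [Ideal.primeCompl]
    rw [this]
    infer_instance
  let : Field (Localization.AtPrime (⊥ : Ideal A)) := IsFractionRing.toField A
  have : Algebra.EssFiniteType A (Localization.AtPrime (⊥ : Ideal A)) :=
    .of_isLocalization _ (⊥ : Ideal A).primeCompl
  have : Algebra.EssFiniteType K (Localization.AtPrime (⊥ : Ideal A)) := .comp K A _
  have : Algebra.IsSmoothAt K (⊥ : Ideal A) :=
    h.formallySmooth_fractionRing (Localization.AtPrime (⊥ : Ideal A))
  exact Algebra.IsSmoothAt.exists_notMem_isStandardSmooth (R := K) (⊥ : Ideal A)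

end DensePoints

/-! ### Infinite existential sets and generic points -/

section Existential

open FirstOrder MvPolynomial

/-- After substituting polynomials for its variables, a term in the language of rings has the values
of a polynomial. -/
theorem FirstOrder.Ring.exists_mvPolynomial_eval_eq_realize {K : Type*} [Field K]
    [FirstOrder.Ring.CompatibleRing K] {α σ : Type*} (t : Language.ring.Term α)
    (v : α → MvPolynomial σ K) :
    ∃ p : MvPolynomial σ K, ∀ z, eval z p = t.realize fun a ↦ eval z (v a) := by
  induction t with
  | var a => exact ⟨v a, fun z ↦ rfl⟩
  | func f ts ih =>
    choose p hp using ih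
    cases f with
    | add => exact ⟨p 0 + p 1, fun z ↦ by
        simp only [map_add, hp, Language.Term.realize]
        exact (FirstOrder.Ring.CompatibleRing.funMap_add (R := K)
          fun i ↦ (ts i).realize fun a ↦ eval z (v a)).symm⟩
    | mul => exact ⟨p 0 * p 1, fun z ↦ by
        simp only [map_mul, hp, Language.Term.realize]
        exact (FirstOrder.Ring.CompatibleRing.funMap_mul (R := K)
          fun i ↦ (ts i).realize fun a ↦ eval z (v a)).symm⟩
    | neg => exact ⟨- p 0, fun z ↦ by
        simp only [map_neg, hp, Language.Term.realize]
        exact (FirstOrder.Ring.CompatibleRing.funMap_neg (R := K)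
          fun i ↦ (ts i).realize fun a ↦ eval z (v a)).symm⟩
    | zero => exact ⟨0, fun z ↦ by
        simp only [map_zero, Language.Term.realize]
        exact (FirstOrder.Ring.CompatibleRing.funMap_zero (R := K) _).symm⟩
    | one => exact ⟨1, fun z ↦ by
        simp only [map_one, Language.Term.realize]
        exact (FirstOrder.Ring.CompatibleRing.funMap_one (R := K) _).symm⟩

/-- Whether a quantifier-free formula holds at a point depends only on which of finitely many
polynomials vanish there. -/
theorem FirstOrder.Language.BoundedFormula.IsQF.exists_finset_mvPolynomial {K : Type*} [Field K]
    [FirstOrder.Ring.CompatibleRing K] {α σ : Type*} {m : ℕ}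
    {ψ : Language.ring.BoundedFormula α m} (hψ : ψ.IsQF) (v : α → MvPolynomial σ K)
    (xs : Fin m → MvPolynomial σ K) :
    ∃ T : Finset (MvPolynomial σ K), ∀ z z' : σ → K, (∀ p ∈ T, eval z p = 0 ↔ eval z' p = 0) →
      (ψ.Realize (fun a ↦ eval z (v a)) (fun i ↦ eval z (xs i)) ↔
        ψ.Realize (fun a ↦ eval z' (v a)) (fun i ↦ eval z' (xs i))) := by
  classical
  induction hψ with
  | falsum => exact ⟨∅, fun z z' _ ↦ Iff.rfl⟩
  | of_isAtomic h =>
    cases h with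
    | equal t₁ t₂ =>
      obtain ⟨p₁, h₁⟩ := Ring.exists_mvPolynomial_eval_eq_realize t₁ (Sum.elim v xs)
      obtain ⟨p₂, h₂⟩ := Ring.exists_mvPolynomial_eval_eq_realize t₂ (Sum.elim v xs)
      have hv : ∀ z : σ → K, (fun a ↦ eval z (Sum.elim v xs a)) =
          Sum.elim (fun a ↦ eval z (v a)) (fun i ↦ eval z (xs i)) := by
        intro z; ext (a | i) <;> rfl
      refine ⟨{p₁ - p₂}, fun z z' h ↦ ?_⟩
      have := h _ (Finset.mem_singleton_self _)
      rw [RingHom.map_sub, RingHom.map_sub, sub_eq_zero, sub_eq_zero, h₁, h₂, h₁, h₂, hv, hv]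
        at this
      exact this
    | rel R => exact R.elim
  | imp _ _ ih₁ ih₂ =>
    obtain ⟨T₁, h₁⟩ := ih₁
    obtain ⟨T₂, h₂⟩ := ih₂
    refine ⟨T₁ ∪ T₂, fun z z' h ↦ ?_⟩
    rw [Language.BoundedFormula.realize_imp, Language.BoundedFormula.realize_imp,
      h₁ z z' fun p hp ↦ h p (Finset.mem_union_left _ hp),
      h₂ z z' fun p hp ↦ h p (Finset.mem_union_right _ hp)]

/-- An existential formula defines a projection of a set `Q` of points of affine space, where
membership in `Q` depends only on which of finitely many polynomials vanish. The coordinate `o` of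
the affine space is that of the variable `x`, and the coordinates `e` are those of the variables
that are still to be quantified. -/
theorem FirstOrder.Language.BoundedFormula.IsExistential.exists_projection {K : Type*} [Field K]
    [FirstOrder.Ring.CompatibleRing K] {n m : ℕ}
    {φ : Language.ring.BoundedFormula (Fin n ⊕ Unit) m} (hφ : φ.IsExistential) (q : Fin n → K) :
    ∃ (l : ℕ) (o : Fin l) (e : Fin m → Fin l) (T : Finset (MvPolynomial (Fin l) K))
      (Q : Set (Fin l → K)),
      (∀ z z' : Fin l → K, (∀ p ∈ T, eval z p = 0 ↔ eval z' p = 0) → z ∈ Q → z' ∈ Q) ∧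
      ∀ (x : K) (xs : Fin m → K), φ.Realize (Sum.elim q fun _ ↦ x) xs ↔
        ∃ z ∈ Q, z o = x ∧ z ∘ e = xs := by
  induction hφ with
  | @of_isQF m ψ h =>
    obtain ⟨T, hT⟩ := h.exists_finset_mvPolynomial (σ := Fin (m + 1))
      (Sum.elim (fun i ↦ C (q i)) fun _ ↦ X (Fin.last m)) (fun i ↦ X i.castSucc)
    have hv : ∀ z : Fin (m + 1) → K, (fun a ↦ eval z (Sum.elim (fun i ↦ C (q i))
        (fun _ : Unit ↦ X (Fin.last m)) a)) = Sum.elim q fun _ ↦ z (Fin.last m) := by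
      intro z; ext (a | i) <;> simp
    simp only [hv, eval_X] at hT
    refine ⟨m + 1, Fin.last m, Fin.castSucc, T,
      {z | ψ.Realize (Sum.elim q fun _ ↦ z (Fin.last m)) fun i ↦ z i.castSucc},
      fun z z' hz hzQ ↦ (hT z z' hz).1 hzQ, fun x xs ↦ ⟨fun h ↦ ?_, ?_⟩⟩
    · exact ⟨Fin.snoc xs x, by simpa using h, by simp, by ext; simp⟩
    · rintro ⟨z, hz, rfl, rfl⟩
      exact hz
  | ex h ih =>
    obtain ⟨l, o, e, T, Q, hQ, hφ⟩ := ih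
    refine ⟨l, o, e ∘ Fin.castSucc, T, Q, hQ, fun x xs ↦ ?_⟩
    simp only [Language.BoundedFormula.realize_ex, hφ]
    constructor
    · rintro ⟨a, z, hz, hzx, hza⟩
      refine ⟨z, hz, hzx, ?_⟩
      rw [← Function.comp_assoc, hza]
      ext; simp
    · rintro ⟨z, hz, hzx, rfl⟩
      refine ⟨z (e (Fin.last _)), z, hz, hzx, ?_⟩
      ext i
      refine Fin.lastCases ?_ (fun i ↦ ?_) i <;> simp

/-- If a set of points of affine space has an infinite projection to the coordinate `o`, then so
does a subset whose vanishing ideal is prime: among the subsets with infinite projection, one with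
maximal vanishing ideal works. -/
theorem MvPolynomial.exists_subset_isPrime_vanishingIdeal {K σ : Type*} [Field K] [Finite σ] (o : σ)
    {W : Set (σ → K)} (hW : ((fun z ↦ z o) '' W).Infinite) :
    ∃ W' ⊆ W, ((fun z ↦ z o) '' W').Infinite ∧ (vanishingIdeal K W').IsPrime := by
  obtain ⟨I, ⟨W', ⟨hW', hinf⟩, rfl⟩, hmax⟩ := WellFounded.has_min
    (wellFounded_gt (α := Ideal (MvPolynomial σ K)))
    ((fun W' ↦ vanishingIdeal K W') '' {W' | W' ⊆ W ∧ ((fun z ↦ z o) '' W').Infinite})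
    ⟨_, W, ⟨subset_rfl, hW⟩, rfl⟩
  refine ⟨W', hW', hinf, ⟨?_, ?_⟩⟩
  · rw [Ne, Ideal.eq_top_iff_one]
    intro h1
    obtain ⟨_, z, hz, -⟩ := hinf.nonempty
    simpa using h1 z hz
  · intro a b hab
    have hsplit : W' = {z ∈ W' | eval z a = 0} ∪ {z ∈ W' | eval z b = 0} := by
      ext z
      refine ⟨fun hz ↦ ?_, fun hz ↦ hz.elim And.left And.left⟩
      have := hab z hz
      simp only [map_mul, mul_eq_zero, aeval_eq_eval] at this
      exact this.imp (fun h ↦ ⟨hz, h⟩) (fun h ↦ ⟨hz, h⟩)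
    have key : ∀ c : MvPolynomial σ K, ((fun z ↦ z o) '' {z ∈ W' | eval z c = 0}).Infinite →
        c ∈ vanishingIdeal K W' := by
      intro c hc
      have hle : vanishingIdeal K W' ≤ vanishingIdeal K {z ∈ W' | eval z c = 0} :=
        fun p hp z hz ↦ hp z hz.1
      have hnlt := hmax _ ⟨_, ⟨(Set.sep_subset _ _).trans hW', hc⟩, rfl⟩
      rw [hle.eq_of_not_lt hnlt]
      intro z hz
      simpa [aeval_eq_eval] using hz.2
    rw [hsplit, Set.image_union, Set.infinite_union] at hinf
    exact hinf.imp (key a) (key b)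

/-- An infinite existentially definable subset `X` of `K` contains the values, at all rational
points, of some transcendental element of a finitely generated domain over `K` with dense rational
points. -/
theorem BigSubfield.exists_transcendental_of_infinite {K : Type u} [Field K]
    [FirstOrder.Ring.CompatibleRing K] {n : ℕ} {φ : Language.ring.Formula (Fin n ⊕ Unit)}
    (hφ : φ.IsExistential) {q : Fin n → K} (hinf : (definedSet φ q).Infinite) :
    ∃ (A : Type u) (_ : CommRing A) (_ : IsDomain A) (_ : Algebra K A),
      Algebra.FiniteType K A ∧ Algebra.HasDensePoints K A ∧
      ∃ x : A, Transcendental K x ∧ ∀ ψ : A →ₐ[K] K, ψ x ∈ definedSet φ q := by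
  classical
  obtain ⟨l, o, e, T, Q, hQ, hφ⟩ := hφ.exists_projection q
  have hX : ∀ x, x ∈ definedSet φ q ↔ ∃ z ∈ Q, z o = x := by
    intro x
    refine (hφ x default).trans ⟨fun ⟨z, hz, hzx, _⟩ ↦ ⟨z, hz, hzx⟩, fun ⟨z, hz, hzx⟩ ↦
      ⟨z, hz, hzx, Subsingleton.elim _ _⟩⟩
  -- By pigeonhole, the points with a fixed vanishing pattern `T'` still have an infinite projection.
  obtain ⟨T', -, hT'⟩ : ∃ T' ∈ T.powerset,
      ((fun z ↦ z o) '' {z ∈ Q | ∀ p ∈ T, eval z p = 0 ↔ p ∈ T'}).Infinite := by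
    by_contra H
    push Not at H
    refine hinf ((T.powerset.finite_toSet.biUnion fun T' hT' ↦
      H T' hT').subset fun x hx ↦ ?_)
    obtain ⟨z, hz, rfl⟩ := (hX x).1 hx
    exact Set.mem_biUnion (x := T.filter fun p ↦ eval z p = 0)
      (Finset.mem_coe.2 (Finset.mem_powerset.2 (Finset.filter_subset _ _)))
      ⟨z, ⟨hz, fun p hp ↦ by simp [hp]⟩, rfl⟩
  obtain ⟨W, hWQ, hW, hI⟩ := exists_subset_isPrime_vanishingIdeal o hT'
  obtain ⟨_, z₀, hz₀, -⟩ := hW.nonempty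
  set I := vanishingIdeal K W with hIdef
  have hmk : ∀ p, Ideal.Quotient.mk I p = 0 ↔ ∀ z ∈ W, eval z p = 0 := by
    intro p
    rw [Ideal.Quotient.eq_zero_iff_mem]
    rfl
  have hdense : Algebra.HasDensePoints K (MvPolynomial (Fin l) K ⧸ I) := by
    intro a ha
    obtain ⟨p, rfl⟩ := Ideal.Quotient.mk_surjective a
    rw [Ne, hmk] at ha
    push Not at ha
    obtain ⟨z, hz, hzp⟩ := ha
    refine ⟨Ideal.Quotient.liftₐ I (aeval z) fun p hp ↦ hp z hz, ?_⟩
    simpa [aeval_eq_eval] using! hzp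
  -- On the open set where the polynomials outside `T'` do not vanish, every rational point of the
  -- variety has the vanishing pattern `T'`.
  let g := ∏ p ∈ T \ T', p
  have hg : Ideal.Quotient.mk I g ≠ 0 := by
    rw [map_prod, Finset.prod_ne_zero_iff]
    intro p hp h0
    rw [Finset.mem_sdiff] at hp
    exact hp.2 (((hWQ hz₀).2 p hp.1).1 ((hmk p).1 h0 z₀ hz₀))
  have hinj : Function.Injective (algebraMap (MvPolynomial (Fin l) K ⧸ I)
      (Localization.Away (Ideal.Quotient.mk I g))) :=
    IsLocalization.injective _ (powers_le_nonZeroDivisors_of_noZeroDivisors hg)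
  refine ⟨Localization.Away (Ideal.Quotient.mk I g), inferInstance,
    IsLocalization.isDomain_localization (powers_le_nonZeroDivisors_of_noZeroDivisors hg),
    inferInstance, ?_, hdense.localizationAway hg,
    algebraMap _ _ (Ideal.Quotient.mk I (X o)), ?_, fun ψ ↦ ?_⟩
  · have : Algebra.FiniteType (MvPolynomial (Fin l) K ⧸ I)
        (Localization.Away (Ideal.Quotient.mk I g)) :=
      IsLocalization.finiteType_of_monoid_fg (Submonoid.powers (Ideal.Quotient.mk I g)) _
    exact Algebra.FiniteType.trans (S := MvPolynomial (Fin l) K ⧸ I) inferInstance inferInstance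
  · rw [transcendental_algebraMap_iff hinj]
    rintro ⟨r, hr0, hr⟩
    refine hW ((r.rootSet_finite K).subset ?_)
    rintro _ ⟨z, hz, rfl⟩
    rw [Polynomial.mem_rootSet]
    refine ⟨hr0, ?_⟩
    have h1 : Polynomial.aeval (Ideal.Quotient.mk I (X o)) r =
        Ideal.Quotient.mk I (Polynomial.aeval (X o) r) :=
      Polynomial.aeval_algHom_apply (Ideal.Quotient.mkₐ K I) (X o) r
    rw [h1, hmk] at hr
    have h2 := hr z hz
    rw [← aeval_eq_eval, ← Polynomial.aeval_algHom_apply] at h2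
    simpa using h2
  · rw [hX]
    let χ : MvPolynomial (Fin l) K →ₐ[K] K := ψ.comp ((IsScalarTower.toAlgHom K
      (MvPolynomial (Fin l) K ⧸ I) (Localization.Away (Ideal.Quotient.mk I g))).comp
      (Ideal.Quotient.mkₐ K I))
    have hχ : ∀ p, eval (fun i ↦ χ (X i)) p = χ p := by
      intro p
      conv_rhs => rw [aeval_unique χ]
      rfl
    have hχ' : ∀ p, χ p = ψ (algebraMap _ _ (Ideal.Quotient.mk I p)) := fun p ↦ rfl
    refine ⟨fun i ↦ χ (X i), hQ z₀ _ (fun p hp ↦ ?_) (hWQ hz₀).1, rfl⟩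
    rw [hχ, hχ', (hWQ hz₀).2 p hp]
    constructor
    · intro hpT
      rw [(hmk p).2 fun z hz ↦ ((hWQ hz).2 p hp).2 hpT, map_zero, map_zero]
    · intro h0
      by_contra hpT
      have hdvd : p ∣ g := Finset.dvd_prod_of_mem _ (Finset.mem_sdiff.2 ⟨hp, hpT⟩)
      obtain ⟨r, hr⟩ := hdvd
      have hu := (IsLocalization.Away.algebraMap_isUnit
        (S := Localization.Away (Ideal.Quotient.mk I g)) (Ideal.Quotient.mk I g)).map ψ
      rw [← hχ', hr, map_mul, hχ', h0, zero_mul] at hu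
      exact not_isUnit_zero hu

end Existential

/-! ### Coordinates over the field of `q`-th powers -/

section NormalForm

variable {K : Type u} {A : Type v} [Field K] [CommRing A] [Algebra K A]

/-- If `x = ∑ cᵢ fᵢ^q` takes values in a subfield `E` at all rational points, then the `cᵢ` may be
replaced by their images under a `K^q`-linear projection of `K` onto `K^q E`. -/
theorem Algebra.HasDensePoints.mem_span_subfield (h : Algebra.HasDensePoints K A) (p n : ℕ)
    [ExpChar K p] [ExpChar A p] (E : Subfield K) {x : A}
    (hx : x ∈ Submodule.span K (Set.range fun f : A ↦ f ^ p ^ n)) (hE : ∀ φ : A →ₐ[K] K, φ x ∈ E) :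
    x ∈ Submodule.span E (Set.range fun f : A ↦ f ^ p ^ n) := by
  set k := (iterateFrobenius K p n).fieldRange with hk
  let M : Submodule k K := Submodule.span k (E : Set K)
  obtain ⟨π, hπ⟩ := M.subtype.exists_leftInverse_of_injective M.ker_subtype
  have hπM : ∀ m ∈ M, (π m : K) = m := fun m hm ↦ congr(Subtype.val ($hπ ⟨m, hm⟩))
  obtain ⟨c, hc⟩ := (Finsupp.mem_span_range_iff_exists_finsupp).1 hx
  -- Applying `π` to the coefficients does not change any value of `x`, because `π` is `K^q`-linear
  -- and fixes the elements of `E`.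
  have hx' : x = c.sum fun f r ↦ (π r : K) • f ^ p ^ n := by
    rw [← sub_eq_zero]
    refine h.eq_zero fun φ ↦ ?_
    rw [map_sub, sub_eq_zero]
    have h1 : φ x = c.sum fun f r ↦ r * φ f ^ p ^ n := by
      rw [← hc]; simp [Finsupp.sum]
    rw [← hπM (φ x) (Submodule.subset_span (hE φ))]
    conv_lhs => rw [h1]
    simp only [Finsupp.sum, map_sum, AddSubmonoidClass.coe_finsetSum, map_smul, map_pow]
    refine Finset.sum_congr rfl fun f _ ↦ ?_
    let r : k := ⟨φ f ^ p ^ n, ⟨φ f, by simp [iterateFrobenius_def]⟩⟩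
    have h2 : c f * φ f ^ p ^ n = r • c f := by
      rw [Subfield.smul_def, smul_eq_mul, mul_comm]
    rw [h2, map_smul, Submodule.coe_smul, Subfield.smul_def, smul_eq_mul, smul_eq_mul, mul_comm]
  rw [hx', Finsupp.sum]
  refine Submodule.sum_mem _ fun f _ ↦ ?_
  have hmem := (π (c f)).2
  generalize (π (c f) : K) = y at hmem
  induction hmem using Submodule.span_induction with
  | mem y hy => exact Submodule.smul_mem _ (⟨y, hy⟩ : E) (Submodule.subset_span ⟨f, rfl⟩)
  | zero => rw [zero_smul]; exact Submodule.zero_mem _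
  | add a b _ _ ha hb => rw [add_smul]; exact Submodule.add_mem _ ha hb
  | smul r y _ hy =>
    obtain ⟨d, hd⟩ := r.2
    have hspan : ∀ z ∈ Submodule.span E (Set.range fun f : A ↦ f ^ p ^ n),
        (r : K) • z ∈ Submodule.span E (Set.range fun f : A ↦ f ^ p ^ n) := by
      intro z hz
      induction hz using Submodule.span_induction with
      | mem z hz =>
        obtain ⟨g, rfl⟩ := hz
        refine Submodule.subset_span ⟨d • g, ?_⟩
        simp only [smul_pow, ← hd, iterateFrobenius_def]
      | zero => rw [smul_zero]; exact Submodule.zero_mem _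
      | add a b _ _ ha hb => rw [smul_add]; exact Submodule.add_mem _ ha hb
      | smul e z _ hz => rw [smul_comm]; exact Submodule.smul_mem _ _ hz
    rw [Subfield.smul_def, smul_eq_mul, mul_smul]
    exact hspan _ hy

/-- An element of the `E`-span of the `q`-th powers of `A` is of the form `∑ εₖ hₖ^q`, where the
`εₖ ∈ E` form a basis of a finite extension of `K^q` inside `K`. -/
theorem exists_eq_sum_smul_pow_of_mem_span_subfield (p n : ℕ) [ExpChar K p] [ExpChar A p]
    (E : Subfield K) {x : A} (hx : x ∈ Submodule.span E (Set.range fun f : A ↦ f ^ p ^ n)) :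
    ∃ (κ : Type u) (_ : Fintype κ) (ε : κ → K) (h : κ → A), (∀ k, ε k ∈ E) ∧
      LinearIndependent (iterateFrobenius K p n).fieldRange ε ∧
      (∀ i j, ε i * ε j ∈ Submodule.span (iterateFrobenius K p n).fieldRange (Set.range ε)) ∧
      x = ∑ k, ε k • h k ^ p ^ n := by
  classical
  set k := (iterateFrobenius K p n).fieldRange with hk
  obtain ⟨c, hc⟩ := (Finsupp.mem_span_range_iff_exists_finsupp).1 hx
  let S : Finset K := c.support.image fun f ↦ (c f : K)
  have hSE : (S : Set K) ⊆ E := by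
    intro y hy
    obtain ⟨f, -, rfl⟩ := Finset.mem_image.1 hy
    exact (c f).2
  have hint : ∀ y : K, IsIntegral k y := fun y ↦
    IsIntegral.of_pow (n := p ^ n) (pow_pos (expChar_pos K p) n) (isIntegral_algebraMap (A := K)
      (x := (⟨y ^ p ^ n, ⟨y, by simp [iterateFrobenius_def]⟩⟩ : k)))
  let M := Algebra.adjoin k (S : Set K)
  have hMfin : Module.Finite k M := by
    have := Algebra.finite_adjoin_of_finite_of_isIntegral (R := k) S.finite_toSet fun y _ ↦ hint y
    exact this
  -- A basis can be chosen among the products of the coefficients, which lie in `E`.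
  obtain ⟨b, hb, hbspan, hbli⟩ := exists_linearIndependent k
    (Submonoid.closure (S : Set K) : Set K)
  rw [← Algebra.adjoin_eq_span] at hbspan
  have hbfin : Finite b := by
    have h1 : Module.Finite k (Submodule.span k (Set.range (Subtype.val : b → K))) := by
      rw [Subtype.range_coe, hbspan]; exact hMfin
    exact Module.Finite.finite_basis (Module.Basis.span hbli)
  have hbfin := Fintype.ofFinite b
  have hbE : ∀ y : b, (y : K) ∈ E := fun y ↦
    (Submonoid.closure_le (S := E.toSubmonoid)).2 hSE (hb y.2)
  have hrange : Submodule.span k (Set.range (Subtype.val : b → K)) = Subalgebra.toSubmodule M := by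
    rw [Subtype.range_coe, hbspan]
  have hcoef : ∀ f ∈ c.support, ∃ d : b → K, (c f : K) = ∑ i, d i ^ p ^ n * i := by
    intro f hf
    have h1 : (c f : K) ∈ Submodule.span k (Set.range (Subtype.val : b → K)) := by
      rw [hrange]
      exact Algebra.subset_adjoin (Finset.mem_image.2 ⟨f, hf, rfl⟩)
    obtain ⟨r, hr⟩ := (Submodule.mem_span_range_iff_exists_fun k).1 h1
    choose d hd using fun i ↦ (r i).2
    refine ⟨d, ?_⟩
    rw [← hr]
    refine Finset.sum_congr rfl fun i _ ↦ ?_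
    rw [Subfield.smul_def, ← hd, iterateFrobenius_def, smul_eq_mul]
  choose! d hd using hcoef
  refine ⟨b, hbfin, Subtype.val, fun i ↦ ∑ f ∈ c.support, d f i • f, hbE, hbli, fun i j ↦ ?_, ?_⟩
  · rw [hrange]
    have hM : ∀ y : b, (y : K) ∈ M := fun y ↦ by
      rw [← Subalgebra.mem_toSubmodule, ← hrange]; exact Submodule.subset_span ⟨y, rfl⟩
    exact M.mul_mem (hM i) (hM j)
  · rw [← hc, Finsupp.sum]
    simp only [sum_pow_char_pow p, Finset.smul_sum]
    rw [Finset.sum_comm]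
    refine Finset.sum_congr rfl fun f hf ↦ ?_
    rw [Subfield.smul_def, hd f hf, Finset.sum_smul]
    refine Finset.sum_congr rfl fun i _ ↦ ?_
    rw [smul_pow, smul_smul, mul_comm]

end NormalForm

/-! ### Tangent vectors at rational points -/

section Tangent

open MvPolynomial

/-- The chain rule for a derivation evaluated at a polynomial expression. -/
theorem Derivation.apply_aeval_eq_sum {K A F : Type*} [CommRing K] [CommRing A] [CommRing F]
    [Algebra K A] [Algebra A F] [Algebra K F] [IsScalarTower K A F] {ι : Type*} [Fintype ι]
    (D : Derivation K F F) (a : ι → A) (f : MvPolynomial ι K) :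
    D (algebraMap A F (aeval a f)) =
      ∑ i, algebraMap A F (aeval a (pderiv i f)) * D (algebraMap A F (a i)) := by
  classical
  induction f using MvPolynomial.induction_on with
  | C c =>
    rw [aeval_C, ← IsScalarTower.algebraMap_apply, Derivation.map_algebraMap]
    simp
  | add f g hf hg => simp only [map_add, hf, hg, add_mul, Finset.sum_add_distrib]
  | mul_X f i hf =>
    simp only [map_mul, aeval_X, Derivation.leibniz, hf, smul_eq_mul, pderiv_X, map_add, add_mul,
      Finset.sum_add_distrib, Finset.mul_sum]
    congr 1
    · simp [Pi.single_apply]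
    · exact Finset.sum_congr rfl fun j _ ↦ by ring

/-- The differential of a polynomial that involves only the variables in the range of `g`. -/
theorem MvPolynomial.sum_eval_pderiv_rename {K : Type*} [CommRing K] {ι τ : Type*} [Fintype ι]
    [Fintype τ] (g : ι → τ) (P v : τ → K) (f : MvPolynomial ι K) :
    ∑ t, eval P (pderiv t (rename g f)) * v t =
      ∑ i, eval (P ∘ g) (pderiv i f) * v (g i) := by
  classical
  induction f using MvPolynomial.induction_on with
  | C c => simp
  | add f₁ f₂ h₁ h₂ => simp [h₁, h₂, add_mul, Finset.sum_add_distrib]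
  | mul_X f i hf =>
    simp only [map_mul, rename_X, Derivation.leibniz, smul_eq_mul, pderiv_X, map_add, add_mul,
      Finset.sum_add_distrib, eval_X]
    congr 1
    · simp [Pi.single_apply, eval_rename]
    · simp only [mul_assoc, ← Finset.mul_sum, hf, Function.comp_apply]

/-- If a derivation of the function field of a smooth affine variety does not kill the function
`h k`, then some rational point has a tangent vector that does not kill it either. The variety is
cut out in affine space by the equations `rel`, with surjective differential at the point `P`; the
vector `v` is tangent at `P`, and the functions `h` are the restrictions of the polynomials `g`.
The point `P` is chosen by density of the rational points; `v` is the value at `P` of the given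
derivation, multiplied by a common denominator. -/
theorem Algebra.HasDensePoints.exists_tangent_vector {K A F κ : Type*} [Field K] [CommRing A]
    [IsDomain A] [Algebra K A] [Algebra.IsStandardSmooth K A] (hA : Algebra.HasDensePoints K A)
    [Field F] [Algebra A F] [IsFractionRing A F] [Algebra K F] [IsScalarTower K A F]
    (D : Derivation K F F) (h : κ → A) (k : κ) (hD : D (algebraMap A F (h k)) ≠ 0) :
    ∃ (ι σ : Type) (_ : Fintype ι) (_ : Finite σ) (rel : σ → MvPolynomial ι K)
      (g : κ → MvPolynomial ι K) (P v : ι → K), (∀ j, eval P (rel j) = 0) ∧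
      (∀ Q : ι → K, (∀ j, eval Q (rel j) = 0) → ∃ ψ : A →ₐ[K] K, ∀ k, ψ (h k) = eval Q (g k)) ∧
      (Function.Surjective fun (u : ι → K) j ↦ ∑ i, eval P (pderiv i (rel j)) * u i) ∧
      (∀ j, ∑ i, eval P (pderiv i (rel j)) * v i = 0) ∧
      ∑ i, eval P (pderiv i (g k)) * v i ≠ 0 := by
  classical
  obtain ⟨ι, σ, hσ, hι, ⟨R⟩⟩ := Algebra.IsStandardSmooth.out (R := K) (S := A)
  have := Fintype.ofFinite ι
  have := Fintype.ofFinite σ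
  have hinj := IsFractionRing.injective A F
  let g : κ → MvPolynomial ι K := fun k ↦ R.σ (h k)
  have hg : ∀ k, aeval R.val (g k) = h k := fun k ↦ R.aeval_val_σ _
  have hrel : ∀ j, aeval R.val (R.relation j) = 0 := R.aeval_val_relation
  obtain ⟨b, hb⟩ := IsLocalization.exist_integer_multiples_of_finite (nonZeroDivisors A)
    fun i ↦ D (algebraMap A F (R.val i))
  choose w hw using hb
  have hw' : ∀ i, algebraMap A F (w i) = algebraMap A F b * D (algebraMap A F (R.val i)) :=
    fun i ↦ by rw [hw, Algebra.smul_def]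
  have hb0 : algebraMap A F b ≠ 0 := fun h0 ↦
    nonZeroDivisors.ne_zero b.2 (hinj (by rw [h0, map_zero]))
  have hsum : ∀ f : MvPolynomial ι K, algebraMap A F (∑ i, aeval R.val (pderiv i f) * w i) =
      algebraMap A F b * D (algebraMap A F (aeval R.val f)) := by
    intro f
    rw [Derivation.apply_aeval_eq_sum, map_sum, Finset.mul_sum]
    refine Finset.sum_congr rfl fun i _ ↦ ?_
    rw [map_mul, hw']
    ring
  obtain ⟨φ, hφ⟩ := hA (∑ i, aeval R.val (pderiv i (g k)) * w i) fun h0 ↦ by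
    have := hsum (g k)
    rw [h0, map_zero, hg] at this
    exact mul_ne_zero hb0 hD this.symm
  have hev : ∀ f : MvPolynomial ι K, eval (fun i ↦ φ (R.val i)) f = φ (aeval R.val f) := by
    intro f
    rw [← AlgHom.comp_apply, comp_aeval, ← coe_aeval_eq_eval]
    rfl
  refine ⟨ι, σ, inferInstance, hσ, R.relation, g, fun i ↦ φ (R.val i), fun i ↦ φ (w i),
    fun j ↦ ?_, fun Q hQ ↦ ?_, fun t ↦ ?_, fun j ↦ ?_, ?_⟩
  · rw [hev, hrel, map_zero]
  · have hker : RingHom.ker (aeval R.val : MvPolynomial ι K →ₐ[K] A) ≤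
        RingHom.ker (aeval Q : MvPolynomial ι K →ₐ[K] K) := by
      have h1 := R.span_range_relation_eq_ker
      rw [Algebra.Generators.ker_eq_ker_aeval_val] at h1
      rw [← h1, Ideal.span_le]
      rintro _ ⟨j, rfl⟩
      exact hQ j
    have hsurj : Function.Surjective (aeval R.val : MvPolynomial ι K →ₐ[K] A) := fun a ↦
      ⟨R.σ a, R.aeval_val_σ a⟩
    refine ⟨AlgHom.liftOfSurjective (aeval R.val) hsurj (aeval Q) hker, fun k ↦ ?_⟩
    rw [← hg k]
    exact AlgHom.liftOfSurjective_apply (aeval R.val) hsurj (aeval Q) hker (g k)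
  · have hdet : IsUnit ((aeval R.val).mapMatrix R.jacobiMatrix).det := by
      have := R.jacobian_isUnit
      rwa [R.jacobian_eq_jacobiMatrix_det, R.algebraMap_eq, RingHom.map_det] at this
    have hbij' : Function.Surjective
        fun (u : ι → A) j ↦ ∑ i, aeval R.val (pderiv i (R.relation j)) * u i := by
      intro t
      obtain ⟨u, hu⟩ := Matrix.vecMul_surjective_iff_isUnit.2
        ((Matrix.isUnit_iff_isUnit_det _).2 hdet) t
      refine ⟨fun l ↦ ∑ i, if R.map i = l then u i else 0, ?_⟩
      rw [← hu]
      ext j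
      simp only [Finset.mul_sum, Matrix.vecMul, dotProduct]
      rw [Finset.sum_comm]
      simp [R.jacobiMatrix_apply, mul_comm]
    obtain ⟨u, hu⟩ := hbij' fun j ↦ algebraMap K A (t j)
    refine ⟨fun i ↦ φ (u i), funext fun j ↦ ?_⟩
    have := congr(φ ($hu j))
    simpa [hev] using this
  · have h1 := hsum (R.relation j)
    rw [hrel, map_zero, map_zero, mul_zero, map_eq_zero_iff _ hinj] at h1
    simpa [hev] using congr(φ $h1)
  · simpa [hev] using hφ

end Tangent

/-! ### Solving for prescribed `q`-th powers -/

section System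

open MvPolynomial

/-- If `x = ∑ εₖ hₖ^q` on a smooth variety, where the `εₖ` are a basis of an algebra over the field
of `q`-th powers and some `hₖ` has a nonzero derivative, then the values of `∑ᵢ εᵢ x(Qᵢ)` at tuples
`Q` of rational points contain a translate of all `∑ₖ εₖ αₖ^q` with `α` small. In terms of the
structure constants `m` of the algebra, `∑ᵢ εᵢ x(Qᵢ) = ∑ₖ εₖ (∑ᵢⱼ m i j k * hⱼ(Qᵢ))^q`, and the
map `Q ↦ (∑ᵢⱼ m i j k * hⱼ(Qᵢ))ₖ` is a submersion at a suitable point of the diagonal. -/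
theorem Valuation.exists_algHom_sum_mul_eq {K A F κ Γ₀ : Type*} [Field K]
    [LinearOrderedCommGroupWithZero Γ₀] (val : Valuation K Γ₀)
    [HenselianLocalRing val.valuationSubring] [CommRing A]
    [IsDomain A] [Algebra K A] [Algebra.IsStandardSmooth K A] (hA : Algebra.HasDensePoints K A)
    [Field F] [Algebra A F] [IsFractionRing A F] [Algebra K F] [IsScalarTower K A F]
    (p n : ℕ) [ExpChar K p] [Fintype κ] (ε : κ → K)
    (hli : LinearIndependent (iterateFrobenius K p n).fieldRange ε)
    (hmul : ∀ i j, ε i * ε j ∈ Submodule.span (iterateFrobenius K p n).fieldRange (Set.range ε))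
    (D : Derivation K F F) (h : κ → A) (k₀ : κ) (hD : D (algebraMap A F (h k₀)) ≠ 0) :
    ∃ φ : A →ₐ[K] K, ∃ c : K, c ≠ 0 ∧ ∀ α : κ → K, (∀ k, val (α k) < val c) →
      ∃ ψ : κ → A →ₐ[K] K, ∑ i, ε i * ψ i (∑ k, ε k • h k ^ p ^ n) =
        ∑ i, ε i * φ (∑ k, ε k • h k ^ p ^ n) + ∑ k, ε k * α k ^ p ^ n := by
  classical
  obtain ⟨ι, σ, hι, hσ, rel, g, P, v, hP, hpt, hsurj, hv, hgv⟩ :=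
    hA.exists_tangent_vector D h k₀ hD
  have hli' : ∀ t : κ → K, ∑ i, ε i * t i ^ p ^ n = 0 → ∀ i, t i = 0 := by
    intro t ht i
    have h1 := (Fintype.linearIndependent_iff.1 hli)
      (fun i ↦ ⟨t i ^ p ^ n, ⟨t i, by simp [iterateFrobenius_def]⟩⟩)
      (by rw [← ht]; exact Finset.sum_congr rfl fun i _ ↦ mul_comm _ _) i
    exact pow_eq_zero_iff (pow_ne_zero _ (expChar_ne_zero K p)) |>.1 congr(Subtype.val $h1)
  have hm : ∀ i j, ∃ m : κ → K, ε i * ε j = ∑ k, ε k * m k ^ p ^ n := by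
    intro i j
    obtain ⟨r, hr⟩ := (Submodule.mem_span_range_iff_exists_fun _).1 (hmul i j)
    choose d hd using fun i ↦ (r i).2
    refine ⟨d, ?_⟩
    rw [← hr]
    refine Finset.sum_congr rfl fun i _ ↦ ?_
    rw [Subfield.smul_def, ← hd, iterateFrobenius_def, smul_eq_mul, mul_comm]
  choose m hm using hm
  have hprod : ∀ b : κ → κ → K, ∑ i, ∑ j, ε i * ε j * b i j ^ p ^ n =
      ∑ k, ε k * (∑ i, ∑ j, m i j k * b i j) ^ p ^ n := by
    intro b
    simp only [sum_pow_char_pow p, mul_pow (m _ _ _), Finset.mul_sum, hm, Finset.sum_mul]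
    rw [Finset.sum_comm]
    refine (Finset.sum_congr rfl fun j _ ↦ Finset.sum_comm).trans ?_
    rw [Finset.sum_comm]
    refine Finset.sum_congr rfl fun k _ ↦ ?_
    rw [Finset.sum_comm]
    simp only [mul_assoc]
  let G : (κ × σ) ⊕ κ → MvPolynomial (κ × ι) K := Sum.elim
    (fun s ↦ rename (Prod.mk s.1) (rel s.2))
    (fun k ↦ ∑ i, ∑ j, C (m i j k) * rename (Prod.mk i) (g j))
  let dg : κ → (ι → K) → K := fun j u ↦ ∑ l, eval P (pderiv l (g j)) * u l
  have hG_inl : ∀ (u : κ × ι → K) i j,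
      ∑ t, eval (fun t : κ × ι ↦ P t.2) (pderiv t (G (.inl (i, j)))) * u t =
        ∑ l, eval P (pderiv l (rel j)) * u (i, l) := fun u i j ↦
    MvPolynomial.sum_eval_pderiv_rename (Prod.mk i) (fun t : κ × ι ↦ P t.2) u (rel j)
  have hG_inr : ∀ (u : κ × ι → K) k,
      ∑ t, eval (fun t : κ × ι ↦ P t.2) (pderiv t (G (.inr k))) * u t =
        ∑ i, ∑ j, m i j k * dg j fun l ↦ u (i, l) := by
    intro u k
    have h1 : ∀ i j, ∑ t, eval (fun t : κ × ι ↦ P t.2) (pderiv t (rename (Prod.mk i) (g j))) * u t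
        = dg j fun l ↦ u (i, l) := fun i j ↦
      MvPolynomial.sum_eval_pderiv_rename (Prod.mk i) (fun t : κ × ι ↦ P t.2) u (g j)
    simp only [G, Sum.elim_inr, map_sum, pderiv_C_mul, RingHom.map_mul,
      eval_C, Finset.sum_mul, ← h1, Finset.mul_sum]
    rw [Finset.sum_comm]
    refine Finset.sum_congr rfl fun i _ ↦ ?_
    rw [Finset.sum_comm]
    simp only [mul_assoc]
  -- Multiplication by `∑ εⱼ γⱼ^q ≠ 0` is injective, so moving the points along multiples of `v`
  -- reaches all directions.
  let L : (κ → K) →ₗ[K] (κ → K) :=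
    LinearMap.pi fun k ↦ ∑ i, (∑ j, m i j k * dg j v) • LinearMap.proj i
  have hL : ∀ t k, L t k = ∑ i, ∑ j, m i j k * (t i * dg j v) := by
    intro t k
    simp only [L, LinearMap.pi_apply, LinearMap.sum_apply, LinearMap.smul_apply,
      LinearMap.proj_apply, smul_eq_mul, Finset.sum_mul]
    exact Finset.sum_congr rfl fun i _ ↦ Finset.sum_congr rfl fun j _ ↦ by ring
  have hLinj : Function.Injective L := by
    rw [injective_iff_map_eq_zero]
    intro t ht
    have h1 := hprod fun i j ↦ t i * dg j v
    simp only [← hL, ht, Pi.zero_apply, zero_pow (pow_ne_zero n (expChar_ne_zero K p)), mul_zero,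
      Finset.sum_const_zero] at h1
    have h2 : (∑ i, ε i * t i ^ p ^ n) * ∑ j, ε j * dg j v ^ p ^ n = 0 := by
      rw [← h1, Finset.sum_mul_sum]
      exact Finset.sum_congr rfl fun i _ ↦ Finset.sum_congr rfl fun j _ ↦ by ring
    obtain h3 | h3 := mul_eq_zero.1 h2
    · exact funext (hli' _ h3)
    · exact absurd (hli' _ h3 k₀) hgv
  have hG : Function.Surjective fun (u : κ × ι → K) s ↦
      ∑ t, eval (fun t : κ × ι ↦ P t.2) (pderiv t (G s)) * u t := by
    intro y
    choose u hu using fun i ↦ hsurj fun j ↦ y (.inl (i, j))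
    obtain ⟨t, ht⟩ := LinearMap.injective_iff_surjective.1 hLinj
      fun k ↦ y (.inr k) - ∑ i, ∑ j, m i j k * dg j (u i)
    refine ⟨fun s ↦ u s.1 s.2 + t s.1 * v s.2, funext ?_⟩
    rintro (⟨i, j⟩ | k)
    · refine (hG_inl _ i j).trans ?_
      have h1 := congr_fun (hu i) j
      simp only at h1
      simp only [mul_add, Finset.sum_add_distrib, h1, mul_left_comm _ (t i), ← Finset.mul_sum, hv,
        mul_zero, add_zero]
    · refine (hG_inr _ k).trans ?_
      have h1 : ∀ i j, dg j (fun l ↦ u i l + t i * v l) = dg j (u i) + t i * dg j v := by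
        intro i j
        simp only [dg, mul_add, Finset.sum_add_distrib, mul_left_comm _ (t i), ← Finset.mul_sum]
      have h2 := congr_fun ht k
      rw [hL] at h2
      simp only [h1, mul_add, Finset.sum_add_distrib, h2]
      ring
  obtain ⟨c, hc, hsol⟩ := val.exists_eval_eq_add_of_surjective G (fun t ↦ P t.2) hG
  obtain ⟨φ, hφ⟩ := hpt P hP
  have heval : ∀ Q : κ × ι → K, ∀ ψ : κ → A →ₐ[K] K,
      (∀ i k, ψ i (h k) = eval (fun l ↦ Q (i, l)) (g k)) →
      ∑ i, ε i * ψ i (∑ k, ε k • h k ^ p ^ n) = ∑ k, ε k * eval Q (G (.inr k)) ^ p ^ n := by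
    intro Q ψ hψ
    have h1 := hprod fun i j ↦ ψ i (h j)
    simp only [map_sum, map_smul, map_pow, Finset.mul_sum, smul_eq_mul, ← mul_assoc]
    rw [h1]
    refine Finset.sum_congr rfl fun k _ ↦ ?_
    simp only [G, Sum.elim_inr, map_sum, map_mul, eval_C, eval_rename, hψ]
    rfl
  refine ⟨φ, c, hc, fun α hα ↦ ?_⟩
  obtain ⟨Q, hQ⟩ := hsol (Sum.elim (fun _ ↦ 0) α) (by
    rintro (s | k)
    · simpa using zero_lt_iff.2 ((Valuation.ne_zero_iff val).2 hc)
    · exact hα k)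
  have hQrel : ∀ i, ∀ j, eval (fun l ↦ Q (i, l)) (rel j) = 0 := by
    intro i j
    have h1 := hQ (.inl (i, j))
    simp only [G, Sum.elim_inl, eval_rename, add_zero] at h1
    exact h1.trans (hP j)
  choose ψ hψ using fun i ↦ hpt _ (hQrel i)
  refine ⟨ψ, ?_⟩
  rw [heval Q ψ hψ, heval (fun t ↦ P t.2) (fun _ ↦ φ) (fun _ k ↦ hφ k), ← Finset.sum_add_distrib]
  refine Finset.sum_congr rfl fun k _ ↦ ?_
  rw [hQ, Sum.elim_inr, add_pow_expChar_pow, mul_add]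

end System

/-! ### Values of a regular function at tuples of rational points -/

section Local

/-- The localization `A[1/f]` is a subring of the fraction field of `A`. -/
theorem Localization.Away.exists_algebra_isFractionRing {K A F : Type*} [CommRing K] [CommRing A]
    [IsDomain A] [Algebra K A] [Field F] [Algebra A F] [IsFractionRing A F] [Algebra K F]
    [IsScalarTower K A F] {f : A} (hf : f ≠ 0) :
    ∃ _ : Algebra (Localization.Away f) F, IsScalarTower A (Localization.Away f) F ∧
      IsScalarTower K (Localization.Away f) F ∧ IsFractionRing (Localization.Away f) F := by
  have hu : IsUnit (algebraMap A F f) :=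
    isUnit_iff_ne_zero.2 fun h ↦ hf (IsFractionRing.injective A F (h.trans (map_zero _).symm))
  let inst : Algebra (Localization.Away f) F :=
    (IsLocalization.Away.lift (S := Localization.Away f) f hu).toAlgebra
  have h1 : IsScalarTower A (Localization.Away f) F := .of_algebraMap_eq fun a ↦
    (IsLocalization.Away.lift_eq (S := Localization.Away f) f hu a).symm
  have h2 : IsScalarTower K (Localization.Away f) F := .of_algebraMap_eq fun a ↦ by
    rw [IsScalarTower.algebraMap_apply K A F, IsScalarTower.algebraMap_apply K A
      (Localization.Away f), ← IsScalarTower.algebraMap_apply A (Localization.Away f) F]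
  exact ⟨inst, h1, h2, IsFractionRing.isFractionRing_of_isDomain_of_isLocalization
    (Submonoid.powers f) _ _⟩

/-- A combination of `q`-th powers in the fraction field of `A` becomes one in a localization of
`A`. -/
theorem exists_algebraMap_mem_span_pow_localizationAway {K A F : Type*} [Field K] [CommRing A]
    [IsDomain A] [Algebra K A] [Field F] [Algebra A F] [IsFractionRing A F] [Algebra K F]
    [IsScalarTower K A F] (m : ℕ) {x : A}
    (hx : algebraMap A F x ∈ Submodule.span K (Set.range fun f : F ↦ f ^ m)) :
    ∃ b : A, b ≠ 0 ∧ algebraMap A (Localization.Away b) x ∈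
      Submodule.span K (Set.range fun f : Localization.Away b ↦ f ^ m) := by
  obtain ⟨c, hc⟩ := (Finsupp.mem_span_range_iff_exists_finsupp).1 hx
  obtain ⟨b, hb⟩ := IsLocalization.exist_integer_multiples_of_finset (nonZeroDivisors A) c.support
  choose! a ha using hb
  have hinj := IsFractionRing.injective A F
  have h1 : (b : A) ^ m * x = ∑ g ∈ c.support, c g • a g ^ m := by
    apply hinj
    rw [map_mul, map_pow, ← hc, Finsupp.sum, Finset.mul_sum, map_sum]
    refine Finset.sum_congr rfl fun g hg ↦ ?_
    rw [Algebra.smul_def (c g) (a g ^ m), map_mul, map_pow, ha g hg,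
      ← IsScalarTower.algebraMap_apply, Algebra.smul_def, Algebra.smul_def, mul_pow]
    ring
  refine ⟨b, nonZeroDivisors.ne_zero b.2, ?_⟩
  have hu : algebraMap A (Localization.Away (b : A)) b * IsLocalization.Away.invSelf (b : A) = 1 :=
    IsLocalization.Away.mul_invSelf (b : A)
  have h2 : algebraMap A (Localization.Away (b : A)) x = ∑ g ∈ c.support,
      c g • (algebraMap A (Localization.Away (b : A)) (a g) *
        IsLocalization.Away.invSelf (b : A)) ^ m := by
    have h3 := congrArg (fun r ↦ algebraMap A (Localization.Away (b : A)) r *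
      IsLocalization.Away.invSelf (b : A) ^ m) h1
    rw [map_mul, map_pow, mul_right_comm, ← mul_pow, hu, one_pow, one_mul, map_sum,
      Finset.sum_mul] at h3
    rw [h3]
    refine Finset.sum_congr rfl fun g _ ↦ ?_
    rw [Algebra.smul_def (c g) (a g ^ m), map_mul, map_pow, ← IsScalarTower.algebraMap_apply,
      Algebra.smul_def, mul_pow, mul_assoc]
  rw [h2]
  exact Submodule.sum_mem _ fun g _ ↦ Submodule.smul_mem _ _ (Submodule.subset_span ⟨_, rfl⟩)

end Local

namespace BigSubfield

/-- The key property of an infinite existential set `X` in a henselian field: up to the `q`-th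
power, every element is a quotient of two differences of combinations of elements of `X` with
coefficients `ε` in the field generated by `X`. -/
theorem exists_pow_mul_sum_eq {K : Type u} [Field K] [FirstOrder.Ring.CompatibleRing K]
    {Γ₀ : Type v} [LinearOrderedCommGroupWithZero Γ₀] (val : Valuation K Γ₀) [val.IsNontrivial]
    [HenselianLocalRing val.valuationSubring] {n : ℕ}
    {φ : FirstOrder.Language.ring.Formula (Fin n ⊕ Unit)} (hφ : φ.IsExistential) {q : Fin n → K}
    (hinf : (definedSet φ q).Infinite) :
    ∃ (N : ℕ) (κ : Type u) (_ : Fintype κ) (ε : κ → K), N ≠ 0 ∧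
      (∀ k, ε k ∈ generatedSubfield φ q) ∧ ∀ a : K, ∃ y : Fin 3 × κ → K,
        (∀ t, y t ∈ definedSet φ q) ∧ ∑ i, ε i * (y (1, i) - y (2, i)) ≠ 0 ∧
        a ^ N * ∑ i, ε i * (y (1, i) - y (2, i)) = ∑ i, ε i * (y (0, i) - y (2, i)) := by
  classical
  obtain ⟨A, _, _, _, hfin, hA, x, hx, hxX⟩ := exists_transcendental_of_infinite hφ hinf
  obtain ⟨p, hp⟩ := ExpChar.exists K
  have hxF : Transcendental K (algebraMap A (FractionRing A) x) :=
    (transcendental_algebraMap_iff (IsFractionRing.injective A (FractionRing A))).2 hx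
  have : Algebra.EssFiniteType K (FractionRing A) :=
    Algebra.EssFiniteType.comp K A (FractionRing A)
  obtain ⟨m, hspan, hder⟩ := exists_mem_span_pow_and_exists_derivation p hxF
  -- Pass to an open subset where `x` is a combination of `q`-th powers, then to a smooth one.
  obtain ⟨b, hb, hxb⟩ := exists_algebraMap_mem_span_pow_localizationAway (p ^ m) hspan
  obtain ⟨_, _, _, _⟩ := Localization.Away.exists_algebra_isFractionRing (K := K)
    (F := FractionRing A) hb
  have : IsDomain (Localization.Away b) :=
    IsLocalization.isDomain_localization (powers_le_nonZeroDivisors_of_noZeroDivisors hb)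
  have hA₁ := hA.localizationAway hb
  obtain ⟨f, hf, hsmooth⟩ := hA₁.exists_isStandardSmooth
  obtain ⟨_, _, _, _⟩ := Localization.Away.exists_algebra_isFractionRing (K := K)
    (F := FractionRing A) hf
  have : IsDomain (Localization.Away f) :=
    IsLocalization.isDomain_localization (powers_le_nonZeroDivisors_of_noZeroDivisors hf)
  have hA₂ := hA₁.localizationAway hf
  set x₁ := algebraMap A (Localization.Away b) x with hx₁
  set x₂ := algebraMap (Localization.Away b) (Localization.Away f) x₁ with hx₂
  have : ExpChar (Localization.Away f) p :=
    expChar_of_injective_algebraMap (algebraMap K (Localization.Away f)).injective p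
  have hx₂X : ∀ ψ : Localization.Away f →ₐ[K] K, ψ x₂ ∈ definedSet φ q := fun ψ ↦
    hxX ((ψ.comp (IsScalarTower.toAlgHom K (Localization.Away b) (Localization.Away f))).comp
      (IsScalarTower.toAlgHom K A (Localization.Away b)))
  have hx₂span : x₂ ∈ Submodule.span K (Set.range fun f : Localization.Away f ↦ f ^ p ^ m) := by
    have h1 := Submodule.mem_map_of_mem
      (f := (Algebra.linearMap (Localization.Away b) (Localization.Away f)).restrictScalars K) hxb
    rw [Submodule.map_span] at h1
    refine Submodule.span_mono ?_ h1
    rintro _ ⟨_, ⟨g, rfl⟩, rfl⟩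
    exact ⟨algebraMap _ _ g, (map_pow (algebraMap _ _) _ _).symm⟩
  obtain ⟨κ, _, ε, h, hε, hli, hmul, hxeq⟩ := exists_eq_sum_smul_pow_of_mem_span_subfield p m
    (generatedSubfield φ q) (hA₂.mem_span_subfield p m _ hx₂span fun ψ ↦
      Subfield.subset_closure (hx₂X ψ))
  obtain ⟨k, -, D, hD⟩ := hder Finset.univ ε
    (fun k ↦ algebraMap (Localization.Away f) (FractionRing A) (h k)) (by
      rw [IsScalarTower.algebraMap_apply A (Localization.Away b) (FractionRing A),
        IsScalarTower.algebraMap_apply (Localization.Away b) (Localization.Away f)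
          (FractionRing A), ← hx₁, ← hx₂, hxeq, map_sum]
      refine Finset.sum_congr rfl fun k _ ↦ ?_
      rw [Algebra.smul_def, map_mul, ← IsScalarTower.algebraMap_apply, ← Algebra.smul_def, map_pow])
  obtain ⟨φ₀, c, hc, hsol⟩ := val.exists_algHom_sum_mul_eq hA₂ p m ε hli hmul D h k hD
  rw [← hxeq] at hsol
  have hpm : p ^ m ≠ 0 := pow_ne_zero _ (expChar_ne_zero K p)
  refine ⟨p ^ m, κ, inferInstance, ε, hpm, hε, fun a ↦ ?_⟩
  -- For small `s ≠ 0` both `s` and `a s` are small, so both `εₖ s^q` and `εₖ (a s)^q` are attained.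
  obtain ⟨s, hs, hs1, hs2⟩ : ∃ s : K, s ≠ 0 ∧ val s < val c ∧ val (a * s) < val c := by
    obtain ⟨e, he, he1⟩ := Valuation.IsNontrivial.exists_lt_one (v := val)
    obtain ⟨d, hd, -, hdle⟩ := val.exists_ne_zero_forall_mul_le_one {c⁻¹, a * c⁻¹}
    have key : ∀ r, val (d * (r * c⁻¹)) ≤ 1 → val (r * (d * e)) < val c := by
      intro r hr
      have h1 : r * (d * e) = (d * (r * c⁻¹)) * e * c := by field_simp
      rw [h1, map_mul, map_mul]
      refine mul_lt_of_lt_one_left (zero_lt_iff.2 ((Valuation.ne_zero_iff val).2 hc)) ?_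
      exact (mul_le_of_le_one_left' hr).trans_lt he1
    refine ⟨d * e, mul_ne_zero hd he, ?_, key a (hdle _ (by simp))⟩
    have := key 1 (by rw [one_mul]; exact hdle _ (by simp))
    rwa [one_mul] at this
  have hsmall : ∀ r : K, val r < val c → ∃ y : κ → K, (∀ i, y i ∈ definedSet φ q) ∧
      ∑ i, ε i * (y i - φ₀ x₂) = ε k * r ^ p ^ m := by
    intro r hr
    obtain ⟨ψ, hψ⟩ := hsol (Pi.single k r) fun j ↦ by
      obtain rfl | hj := eq_or_ne j k
      · rwa [Pi.single_eq_same]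
      · rw [Pi.single_eq_of_ne hj, Valuation.map_zero]
        exact zero_lt_iff.2 ((Valuation.ne_zero_iff val).2 hc)
    refine ⟨fun i ↦ ψ i x₂, fun i ↦ hx₂X _, ?_⟩
    simp only [mul_sub, Finset.sum_sub_distrib]
    rw [hψ, add_sub_cancel_left, Finset.sum_eq_single k]
    · rw [Pi.single_eq_same]
    · intro j _ hj
      rw [Pi.single_eq_of_ne hj, zero_pow hpm, mul_zero]
    · simp
  obtain ⟨y, hy, hye⟩ := hsmall _ hs2
  obtain ⟨y', hy', hye'⟩ := hsmall _ hs1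
  refine ⟨fun t ↦ ![y t.2, y' t.2, φ₀ x₂] t.1, ?_, ?_, ?_⟩
  · rintro ⟨t, i⟩
    fin_cases t
    exacts [hy i, hy' i, hx₂X φ₀]
  · change ∑ i, ε i * (y' i - φ₀ x₂) ≠ 0
    rw [hye']
    exact mul_ne_zero (hli.ne_zero k) (pow_ne_zero _ hs)
  · change a ^ p ^ m * ∑ i, ε i * (y' i - φ₀ x₂) = ∑ i, ε i * (y i - φ₀ x₂)
    rw [hye, hye', mul_pow]
    ring

end BigSubfield

/-! ### Transfer to elementary extensions -/

namespace BigSubfield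

open FirstOrder Language

/-- The algebraic exponent is at most `N` if the `N`-th powers all lie in the subfield. -/
theorem algex_le_of_forall_pow_mem {F : Type u} [Field F] {E : Subfield F} {N : ℕ} (hN : N ≠ 0)
    (h : ∀ a : F, a ^ N ∈ E) : algex E ≤ N := by
  refine iSup_le fun a ↦ ?_
  let f : Polynomial E := Polynomial.X ^ N - Polynomial.C ⟨a ^ N, h a⟩
  have hf : f.Monic := Polynomial.monic_X_pow_sub_C _ hN
  have hfa : Polynomial.aeval a f = 0 := by
    simp only [f, map_sub, map_pow, Polynomial.aeval_X, Polynomial.aeval_C]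
    exact sub_self _
  have hint : IsIntegral E a := ⟨f, hf, hfa⟩
  have := IntermediateField.adjoin.finiteDimensional hint
  rw [← Module.finrank_eq_rank, Cardinal.toENat_nat, IntermediateField.adjoin.finrank hint]
  have h1 := Polynomial.natDegree_le_of_dvd (minpoly.dvd E a hfa) hf.ne_zero
  rw [Polynomial.natDegree_X_pow_sub_C] at h1
  exact_mod_cast h1

/-- An elementary embedding of fields, as a ring homomorphism. -/
def ringHomOfElementaryEmbedding {F : Type u} {F' : Type w} [Field F] [Field F']
    [Ring.CompatibleRing F] [Ring.CompatibleRing F'] (j : F ↪ₑ[Language.ring] F') : F →+* F' where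
  toFun := j
  map_one' := by
    simpa [Ring.CompatibleRing.funMap_one] using j.map_fun FirstOrder.ringFunc.one ![]
  map_zero' := by
    simpa [Ring.CompatibleRing.funMap_zero] using j.map_fun FirstOrder.ringFunc.zero ![]
  map_add' x y := by
    simpa [Ring.CompatibleRing.funMap_add] using j.map_fun FirstOrder.ringFunc.add ![x, y]
  map_mul' x y := by
    simpa [Ring.CompatibleRing.funMap_mul] using j.map_fun FirstOrder.ringFunc.mul ![x, y]

/-- An elementary embedding maps the generated subfield into the generated subfield. -/
theorem map_mem_generatedSubfield {F : Type u} {F' : Type w} [Field F] [Field F']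
    [Ring.CompatibleRing F] [Ring.CompatibleRing F'] (j : F ↪ₑ[Language.ring] F') {n : ℕ}
    {φ : Language.ring.Formula (Fin n ⊕ Unit)} {q : Fin n → F} {x : F}
    (hx : x ∈ generatedSubfield φ q) : j x ∈ generatedSubfield φ (j ∘ q) := by
  have hle : generatedSubfield φ q ≤
      (generatedSubfield φ (j ∘ q)).comap (ringHomOfElementaryEmbedding j) := by
    refine Subfield.closure_le.2 fun y hy ↦ Subfield.subset_closure ?_
    have h1 := (j.map_formula φ (Sum.elim q fun _ ↦ y)).2 hy
    rw [Sum.comp_elim] at h1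
    exact h1
  exact hle hx

/-- The formula, in parameters `q` and `ε`, which says that for all `a` there are elements `y` of the
set defined by `φ(x; q)` such that `a ^ N * ∑ᵢ εᵢ (y₁ᵢ - y₂ᵢ) = ∑ᵢ εᵢ (y₀ᵢ - y₂ᵢ)` and the sum on the
left is nonzero. -/
noncomputable def quotientFormula {n : ℕ} (φ : Language.ring.Formula (Fin n ⊕ Unit)) (N : ℕ)
    (κ : Type v) [Fintype κ] : Language.ring.Formula (Fin n ⊕ κ) :=
  let e : κ → FreeCommRing (((Fin n ⊕ κ) ⊕ Unit) ⊕ (Fin 3 × κ)) := fun i ↦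
    FreeCommRing.of (.inl (.inl (.inr i)))
  let y : Fin 3 → κ → FreeCommRing (((Fin n ⊕ κ) ⊕ Unit) ⊕ (Fin 3 × κ)) := fun l i ↦
    FreeCommRing.of (.inr (l, i))
  let a : FreeCommRing (((Fin n ⊕ κ) ⊕ Unit) ⊕ (Fin 3 × κ)) := FreeCommRing.of (.inl (.inr ()))
  Formula.iAlls Unit (Formula.iExs (Fin 3 × κ)
    ((Formula.iInf fun t : Fin 3 × κ ↦ φ.relabel (Sum.elim (fun i ↦ .inl (.inl (.inl i)))
      fun _ ↦ .inr t)) ⊓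
    (∼((Ring.termOfFreeCommRing (∑ i, e i * (y 1 i - y 2 i))).equal
      (Ring.termOfFreeCommRing 0)) ⊓
    (Ring.termOfFreeCommRing (a ^ N * ∑ i, e i * (y 1 i - y 2 i))).equal
      (Ring.termOfFreeCommRing (∑ i, e i * (y 0 i - y 2 i))))))

theorem realize_quotientFormula {n : ℕ} (φ : Language.ring.Formula (Fin n ⊕ Unit)) (N : ℕ)
    (κ : Type v) [Fintype κ] {F : Type u} [Field F] [Ring.CompatibleRing F] (q : Fin n → F)
    (ε : κ → F) : (quotientFormula φ N κ).Realize (Sum.elim q ε) ↔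
      ∀ a : F, ∃ y : Fin 3 × κ → F,
        (∀ t, y t ∈ definedSet φ q) ∧ ∑ i, ε i * (y (1, i) - y (2, i)) ≠ 0 ∧
        a ^ N * ∑ i, ε i * (y (1, i) - y (2, i)) = ∑ i, ε i * (y (0, i) - y (2, i)) := by
  rw [quotientFormula, Formula.realize_iAlls]
  refine (Equiv.funUnique Unit F).forall_congr fun b ↦ ?_
  rw [Formula.realize_iExs]
  refine exists_congr fun z ↦ ?_
  rw [Formula.realize_inf, Formula.realize_inf, Formula.realize_iInf, Formula.realize_not,
    Formula.realize_equal, Formula.realize_equal]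
  simp only [Formula.realize_relabel, Ring.realize_termOfFreeCommRing, map_sum, map_mul, map_sub,
    map_pow, map_zero, FreeCommRing.lift_of, Sum.elim_inl, Sum.elim_inr, ne_eq]
  refine and_congr (forall_congr' fun t ↦ ?_) Iff.rfl
  rw [Sum.comp_elim]
  rfl

end BigSubfield

theorem mainTheorem4 {K : Type u} [Field K] [FirstOrder.Ring.CompatibleRing K]
    {Γ₀ : Type v} [LinearOrderedCommGroupWithZero Γ₀] (val : Valuation K Γ₀) [val.IsNontrivial]
    [HenselianLocalRing val.valuationSubring] (E : Subfield K) {n : ℕ}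
    (φ : FirstOrder.Language.ring.Formula (Fin n ⊕ Unit)) (q : Fin n → K)
    (hE : BigSubfield.ExistentiallyGeneratedBy E φ q) :
    BigSubfield.IsUniformlyBig.{u, w} φ q := by
  intro F' _ _ j
  obtain ⟨N, κ, _, ε, hN, hε, hK⟩ :=
    BigSubfield.exists_pow_mul_sum_eq val hE.isExistential hE.infinite
  have hF' := (j.map_formula _ _).2 ((BigSubfield.realize_quotientFormula φ N κ q ε).2 hK)
  rw [Sum.comp_elim, BigSubfield.realize_quotientFormula] at hF'
  refine (BigSubfield.algex_le_of_forall_pow_mem hN fun a ↦ ?_).trans_lt (ENat.natCast_lt_top N)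
  obtain ⟨y, hy, hne, heq⟩ := hF' a
  have hmem : ∀ k l, ∑ i, (j ∘ ε) i * (y (k, i) - y (l, i)) ∈
      BigSubfield.generatedSubfield φ (j ∘ q) := fun k l ↦
    Subfield.sum_mem _ fun i _ ↦ Subfield.mul_mem _ (BigSubfield.map_mem_generatedSubfield j (hε i))
      (Subfield.sub_mem _ (Subfield.subset_closure (hy _)) (Subfield.subset_closure (hy _)))
  rw [eq_div_of_mul_eq hne heq]
  exact Subfield.div_mem _ (hmem 0 2) (hmem 1 2)
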